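/- **Setting.** Let $F$ be a commutative $\mathbb C$-algebra with a derivation $\partial_X$ (functions of $X=t_0$; for example smooth functions on an interval, or $\mathbb C[[X]]$). For a commutative $\mathbb C$-algebra $K$ put $\mathrm{Ser}(K)=K[[t_1,t_2,\dots]][[\epsilon]]$; derivations of $K$ act on it coefficientwise, and $\partial_{t_0}:=\partial_X$. If $K$ carries a derivation $\partial_x$, let $\Lambda^{s}=e^{s\epsilon\partial_x}$ ($s\in\mathbb Z$) be the shift $f(x)\mapsto f(x+s\epsilon)$, a formal Taylor series in $\epsilon$. *NLS.* For functions $q,r$ let $R^{\rm NLS}(\xi)=\begin{pmatrix}2+a&b\\ c&-a\end{pmatrix}$, $a=\sum_{j\ge0}A_j\xi^{-j-1}$, $b=\sum_{j\ge0} B_j\xi^{-j-1}$, $c=\sum_{j\ge0} C_j\xi^{-j-1}$, be the basic matrix resolvent of $\epsilon\partial_X+\begin{pmatrix}-\xi&-q\\ r&\xi\end{pmatrix}$, that is, $A_0=0$, $B_0=q$, $C_0=-r$, and for $k\ge0$ $B_{k+1}=\tfrac12\epsilon\partial_XB_k+qA_k$, $C_{k+1}=-\tfrac12\epsilon\partial_XC_k-rA_k$,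 $A_{k+1}=-\tfrac12\sum_{i+j=k}(A_iA_j+B_iC_j)$. The NLS hierarchy is $\epsilon\,\partial q/\partial t_j=2^{j+1}B_{j+1}$, $\epsilon\,\partial r/\partial t_j=2^{j+1}C_{j+1}$, $j\ge0$. Its tau-structure is defined by $\sum_{i,j\ge0}\frac{\Omega^{\rm NLS}_{i,j}}{2^{i+j}\xi^{i+2}\nu^{j+2}}=\frac{\operatorname{tr}R^{\rm NLS}(\xi)R^{\rm NLS}(\nu)-4}{(\xi-\nu)^2}$. *Toda.* For functions $v,w$ let $R(\lambda)=\begin{pmatrix}1+\alpha&\beta\\ \gamma&-\alpha\end{pmatrix}$, $\alpha=\sum_{j\ge0} a_j\lambda^{-j-1}$, $\gamma=\sum_{j\ge0} c_j\lambda^{-j-1}$, $\beta=-w\Lambda(\gamma)$, be the basic matrix resolvent of $\Lambda+\begin{pmatrix}v-\lambda&w\\-1&0\end{pmatrix}$, that is, $a_0=0$, $c_0=1$, and for $k\ge0$ $c_{k+1}=\Lambda^{-1}(v)c_k+a_k+\Lambda^{-1}(a_k)$, $a_{k+1}=\sum_{i+j=k}(wc_i\Lambda(c_j)-a_ia_j)$.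 The Toda lattice hierarchy is $\epsilon\,\partial v/\partial t_j=(\Lambda-1)a_{j+1}$, $\epsilon\,\partial w/\partial t_j=w(\Lambda-1)c_{j+1}$, $j\ge0$. Its tau-structure is defined by $\sum_{i,j\ge0}\frac{\Omega_{i,j}}{\lambda^{i+2}\mu^{j+2}}=\frac{\operatorname{tr}R(\lambda)R(\mu)-1}{(\lambda-\mu)^2}$. The tau-function $\tau$ of a solution $(v,w)$ is characterized by $\epsilon^2\partial_{t_i}\partial_{t_j}\log\tau=\Omega_{i,j}$, $\epsilon\,\partial_{t_i}(\Lambda-1)\log\tau=\Lambda(c_{i+1})$ and $(\Lambda+\Lambda^{-1}-2)\log\tau=\log w$ (that is, $\tau(x+\epsilon)\tau(x-\epsilon)/\tau(x)^2=w$). **Theorem.** Let $(q,r)$ be a solution of the NLS hierarchy with $\epsilon\log q=\varphi\in\mathrm{Ser}(F)$ and $qr=W\in\mathrm{Ser}(F)$; put $V=\epsilon\,\partial_X(q)/q=\partial_X\varphi$. Assume that the system $(\Lambda-1)(w)=\epsilon\,\partial_X(v)$, $w\,(1-\Lambda^{-1})(v)=\epsilon\,\partial_X(w)$, $v|_{x=0}=V$,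 $w|_{x=0}=W$, has a unique solution $(v,w)$ with $v,w\in\mathrm{Ser}(F[[x]])$. Then $(v,w)$ satisfies the Toda lattice hierarchy. Furthermore, let $G$ be a commutative $\mathbb C$-algebra with commuting derivations $\partial_x,\partial_X$ for which closed 1-forms are exact (if $\partial_Xa=\partial_xb$, then $a=\partial_xf$, $b=\partial_Xf$ for some $f\in G$), with a $\mathbb C$-algebra homomorphism $F[[x]]\to G$ that commutes with $\partial_x$ and $\partial_X$, such that the image of $w$ is a unit of $\mathrm{Ser}(G)$ and has a logarithm $\log w\in\mathrm{Ser}(G)$ (an element whose derivatives with respect to $x$ and all $t_k$, $k\ge0$, are $\partial w/w$; its additive constant may be chosen arbitrarily, and the normalization $q/\Lambda^{-1}(q)=w$ below is understood with this choice). Then: 1. There is $q=q(x;\mathbf t;\epsilon)$ with $\epsilon\log q\in\mathrm{Ser}(G)$ and $(1-\Lambda^{-1})\log q=\log w$, $\epsilon\,\frac{\partial\log q}{\partial t_k}=\Lambda(c_{k+1})$, $k\ge0$, and $\log q$ is unique up to adding an element whose derivatives with respect to $x$ and all $t_k$, $k\ge 0$, vanish. 2. For every such $q$, with $r(x;\mathbf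 t;\epsilon):=1/q(x-\epsilon;\mathbf t;\epsilon)$ (so that $qr=w$), there is $\tau^{\rm NLS}=\tau^{\rm NLS}(x;\mathbf t;\epsilon)$ with $\epsilon^2\log\tau^{\rm NLS}\in\mathrm{Ser}(G)$ such that $\epsilon^2\frac{\partial^2\log\tau^{\rm NLS}}{\partial t_i\partial t_j}=\Omega^{\rm NLS}_{i,j}\big|_{q(x;\mathbf t;\epsilon),\,r(x;\mathbf t;\epsilon)}$, $\epsilon(\Lambda-1)\frac{\partial\log\tau^{\rm NLS}}{\partial t_k}=\Lambda(c_{k+1})$, $(\Lambda+\Lambda^{-1}-2)\log\tau^{\rm NLS}=\log q+\log r$ for all $i,j,k\ge0$, where $\log r=-\Lambda^{-1}\log q$. 3. Every such $\tau^{\rm NLS}$ is a tau-function of the solution $(v,w)$ of the Toda lattice hierarchy. -/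

import Mathlib

open scoped BigOperators

noncomputable section

namespace TodaNLS

/-! ### Formal series and the operators acting on them -/

section Series

variable {σ : Type*} {K : Type*} [CommRing K] [Algebra ℂ K]

/-- The coefficientwise extension of a derivation of `K` to `K⟦σ⟧`
(also used for `PowerSeries K`, which is the case `σ = Unit`). -/
def mapDeriv (d : Derivation ℂ K K) :
    Derivation ℂ (MvPowerSeries σ K) (MvPowerSeries σ K) :=
  Derivation.mk'
    { toFun := fun f m => d (MvPowerSeries.coeff m f)
      map_add' := fun f g => by
        funext m; exact (congrArg d (map_add _ f g)).trans (map_add d _ _)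
      map_smul' := fun c f => by
        funext m
        change d (c • MvPowerSeries.coeff m f) = c • d (MvPowerSeries.coeff m f)
        exact d.map_smul c _ }
    (fun f g => by
      classical
      ext m
      change d (MvPowerSeries.coeff m (f * g)) = _
      rw [smul_eq_mul, smul_eq_mul, map_add, MvPowerSeries.coeff_mul,
        mul_comm g, MvPowerSeries.coeff_mul, MvPowerSeries.coeff_mul, map_sum,
        ← Finset.sum_add_distrib]
      refine Finset.sum_congr rfl fun p _ => ?_
      change d (MvPowerSeries.coeff p.1 f * MvPowerSeries.coeff p.2 g)
        = MvPowerSeries.coeff p.1 f * d (MvPowerSeries.coeff p.2 g)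
          + d (MvPowerSeries.coeff p.1 f) * MvPowerSeries.coeff p.2 g
      rw [Derivation.leibniz, smul_eq_mul, smul_eq_mul, mul_comm (MvPowerSeries.coeff p.2 g)])

/-- `Ser K = K[[t₁, t₂, …]][[ε]]`: power series in the times `t_{>0}` and in `ε` with coefficients
in `K`, a ring of functions of the remaining variables (`X = t₀`, or `x` and `X`).
The variable of `MvPowerSeries ℕ K` with index `k` is `t_{k+1}`. -/
abbrev Ser (K : Type*) [CommRing K] : Type _ := PowerSeries (MvPowerSeries ℕ K)

/-- The element `ε` of `Ser K`. -/
def eps : Ser K := PowerSeries.X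

/-- The coefficientwise ring homomorphism `Ser K → Ser K'` induced by `K → K'`. -/
def serMap {K' : Type*} [CommRing K'] (f : K →+* K') : Ser K →+* Ser K' :=
  PowerSeries.map (MvPowerSeries.map f)

/-- A derivation of the coefficient ring `K`, extended to `Ser K`
(killing all `t_k` with `k > 0`, and `ε`). -/
def serDeriv (d : Derivation ℂ K K) : Derivation ℂ (Ser K) (Ser K) :=
  mapDeriv (mapDeriv d)

/-- `∂/∂t_j` on `Ser K`, for `j ≥ 0`. Here `t₀ = X`, and `dX` is `∂_X` on the coefficients. -/
def dt (dX : Derivation ℂ K K) : ℕ → Derivation ℂ (Ser K) (Ser K)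
  | 0 => serDeriv dX
  | k + 1 => mapDeriv ((MvPowerSeries.pderiv K k).restrictScalars ℂ)

/-- The shift `Λ^s : f(x) ↦ f(x + sε)` on `Ser K`, as the formal Taylor series
`∑ₖ (sε)^k / k! ∂ₓ^k f`, where `dx` is `∂ₓ` on the coefficients. -/
def shift (dx : Derivation ℂ K K) (s : ℤ) (f : Ser K) : Ser K :=
  PowerSeries.mk fun n => ∑ k ∈ Finset.range (n + 1),
    ((s : ℂ) ^ k / (k.factorial : ℂ)) •
      (⇑(mapDeriv (σ := ℕ) dx))^[k] (PowerSeries.coeff (n - k) f)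

end Series

/-! ### The basic matrix resolvents and the tau-structures

A matrix resolvent depending polynomially on a jet (or on a lattice) is evaluated directly on the
functions that are substituted for the jet (lattice) variables. -/

section NLS

variable {S : Type*} [CommRing S] [Algebra ℂ S]

/-- The coefficients `(A_j, B_j, C_j)` of the basic matrix resolvent
`[[2 + a(ξ), b(ξ)], [c(ξ), -a(ξ)]]`, with `a = ∑ A_j ξ^{-j-1}` and so on, of
`ε∂ + [[-ξ, -q], [r, ξ]]`, evaluated at `q, r ∈ S`; the operator `D` on `S` is `ε∂`.
These are the recursions given by `[L, R] = 0` and `det R = 0`. -/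
def nlsCoeff (D : S → S) (q r : S) : ℕ → S × S × S
  | 0 => (0, q, -r)
  | k + 1 =>
    (-((1 / 2 : ℂ) • ∑ i : Fin (k + 1),
        ((nlsCoeff D q r i.1).1 * (nlsCoeff D q r (k - i.1)).1
          + (nlsCoeff D q r i.1).2.1 * (nlsCoeff D q r (k - i.1)).2.2)),
      (1 / 2 : ℂ) • D (nlsCoeff D q r k).2.1 + q * (nlsCoeff D q r k).1,
      -((1 / 2 : ℂ) • D (nlsCoeff D q r k).2.2) - r * (nlsCoeff D q r k).1)
termination_by k => k

/-- `A_j`. -/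
def nlsA (D : S → S) (q r : S) (j : ℕ) : S := (nlsCoeff D q r j).1
/-- `B_j`. -/
def nlsB (D : S → S) (q r : S) (j : ℕ) : S := (nlsCoeff D q r j).2.1
/-- `C_j`. -/
def nlsC (D : S → S) (q r : S) (j : ℕ) : S := (nlsCoeff D q r j).2.2

/-- The coefficient of `ξ^{-m}` in the basic matrix resolvent `R^NLS(ξ)`. -/
def nlsRes (D : S → S) (q r : S) : ℕ → Matrix (Fin 2) (Fin 2) S
  | 0 => !![2, 0; 0, 0]
  | j + 1 => !![nlsA D q r j, nlsB D q r j; nlsC D q r j, -nlsA D q r j]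

/-- The tau-structure `Ω_{i,j}^NLS`, defined by
`∑ Ω_{i,j} 2^{-i-j} ξ^{-i-2} ν^{-j-2} = (tr R(ξ) R(ν) - 4) / (ξ - ν)²`.
The right-hand side is a series in `ξ⁻¹, ν⁻¹`, so its coefficients can be read off with the
expansion `(ξ - ν)^{-2} = ∑ₖ (k + 1) ξ^{-k-2} ν^k`; the constant `4` does not contribute. -/
def nlsOmega (D : S → S) (q r : S) (i j : ℕ) : S :=
  2 ^ (i + j) * ∑ k ∈ Finset.range (i + 1),
    ((k : S) + 1) * (nlsRes D q r (i - k) * nlsRes D q r (j + 2 + k)).trace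

end NLS

section Toda

variable {S : Type*} [CommRing S]

/-- The coefficients `(a_j, c_j)` of the basic matrix resolvent
`[[1 + α(λ), β(λ)], [γ(λ), -α(λ)]]`, with `α = ∑ a_j λ^{-j-1}` and so on, of
`Λ + [[v - λ, w], [-1, 0]]`, evaluated at `v, w ∈ S`; `sh s` is the operator `Λ^s` on `S`. -/
def todaCoeff (sh : ℤ → S → S) (v w : S) : ℕ → S × S
  | 0 => (0, 1)
  | k + 1 =>
    (∑ i : Fin (k + 1),
        (w * (todaCoeff sh v w i.1).2 * sh 1 (todaCoeff sh v w (k - i.1)).2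
          - (todaCoeff sh v w i.1).1 * (todaCoeff sh v w (k - i.1)).1),
      sh (-1) v * (todaCoeff sh v w k).2 + (todaCoeff sh v w k).1
        + sh (-1) (todaCoeff sh v w k).1)
termination_by k => k

/-- `a_j`. -/
def todaA (sh : ℤ → S → S) (v w : S) (j : ℕ) : S := (todaCoeff sh v w j).1
/-- `c_j`. -/
def todaC (sh : ℤ → S → S) (v w : S) (j : ℕ) : S := (todaCoeff sh v w j).2
/-- `b_j`, that is, `β = -w Λ(γ)`. -/
def todaB (sh : ℤ → S → S) (v w : S) (j : ℕ) : S := -(w * sh 1 (todaC sh v w j))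

/-- The coefficient of `λ^{-m}` in the basic matrix resolvent `R(λ)`. -/
def todaRes (sh : ℤ → S → S) (v w : S) : ℕ → Matrix (Fin 2) (Fin 2) S
  | 0 => !![1, 0; 0, 0]
  | j + 1 => !![todaA sh v w j, todaB sh v w j; todaC sh v w j, -todaA sh v w j]

/-- The tau-structure `Ω_{i,j}` of the Toda lattice hierarchy, defined by
`∑ Ω_{i,j} λ^{-i-2} μ^{-j-2} = (tr R(λ) R(μ) - 1) / (λ - μ)²`
(coefficients read off as for `nlsOmega`). -/
def todaOmega (sh : ℤ → S → S) (v w : S) (i j : ℕ) : S :=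
  ∑ k ∈ Finset.range (i + 1),
    ((k : S) + 1) * (todaRes sh v w (i - k) * todaRes sh v w (j + 2 + k)).trace

end Toda

/-! ### The NLS hierarchy -/

section NLSHierarchy

variable {K : Type*} [CommRing K] [Algebra ℂ K]

/-- The ring `Ser K [E, E⁻¹]`, where `E = T 1` stands for `e^{φ/ε}` with some fixed `φ ∈ Ser K`. -/
abbrev ExpSer (K : Type*) [CommRing K] : Type _ := LaurentPolynomial (Ser K)

/-- For a derivation `d` of `Ser K`, the operator `ε d` on `Ser K [E, E⁻¹]` with `E = e^{φ/ε}`: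
`ε d (b E^n) = (ε d(b) + n d(φ) b) E^n`. -/
def epsDeriv (d : Derivation ℂ (Ser K) (Ser K)) (φ : Ser K) (f : ExpSer K) : ExpSer K :=
  f.coeff.sum fun n b =>
    LaurentPolynomial.C (eps * d b + (n : Ser K) * d φ * b) * LaurentPolynomial.T n

/-- `q = e^{φ/ε}`. -/
def qOf (K : Type*) [CommRing K] : ExpSer K := LaurentPolynomial.T 1

/-- `r = W / q = W e^{-φ/ε}`, so that `q r = W`. -/
def rOf (W : Ser K) : ExpSer K := LaurentPolynomial.C W * LaurentPolynomial.T (-1)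

/-- The pair `(q, r)` with `ε log q = φ` and `q r = W` is a solution of the NLS hierarchy
`ε ∂q/∂t_j = 2^{j+1} B_{j+1}`, `ε ∂r/∂t_j = 2^{j+1} C_{j+1}`, `j ≥ 0`, with `t₀ = X`. -/
def IsNLSSolution (dX : Derivation ℂ K K) (φ W : Ser K) : Prop :=
  ∀ j : ℕ,
    epsDeriv (dt dX j) φ (qOf K)
        = 2 ^ (j + 1) * nlsB (epsDeriv (dt dX 0) φ) (qOf K) (rOf W) (j + 1) ∧
    epsDeriv (dt dX j) φ (rOf W)
        = 2 ^ (j + 1) * nlsC (epsDeriv (dt dX 0) φ) (qOf K) (rOf W) (j + 1)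

/-- `Ω_{i,j}^NLS` evaluated at the pair `(q, r)` with `ε log q = φ` and `q r = W`. -/
def nlsOmegaAt (dX : Derivation ℂ K K) (φ W : Ser K) (i j : ℕ) : ExpSer K :=
  nlsOmega (epsDeriv (dt dX 0) φ) (qOf K) (rOf W) i j

end NLSHierarchy

/-! ### The Toda lattice hierarchy and tau-functions -/

section TodaHierarchy

variable {K : Type*} [CommRing K] [Algebra ℂ K]

/-- The Toda lattice hierarchy `ε ∂v/∂t_j = (Λ - 1) a_{j+1}`, `ε ∂w/∂t_j = w (Λ - 1) c_{j+1}`,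
`j ≥ 0`, with `t₀ = X`. -/
def IsTodaSolution (dx dX : Derivation ℂ K K) (v w : Ser K) : Prop :=
  ∀ j : ℕ,
    eps * dt dX j v
        = shift dx 1 (todaA (shift dx) v w (j + 1)) - todaA (shift dx) v w (j + 1) ∧
    eps * dt dX j w
        = w * (shift dx 1 (todaC (shift dx) v w (j + 1)) - todaC (shift dx) v w (j + 1))

/-- The difference system `(Λ - 1) w = ε ∂_X v`, `w (1 - Λ⁻¹) v = ε ∂_X w`. -/
def IsDifferenceSolution (dx dX : Derivation ℂ K K) (v w : Ser K) : Prop :=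
  shift dx 1 w - w = eps * dt dX 0 v ∧ w * (v - shift dx (-1) v) = eps * dt dX 0 w

/-- `L` is a logarithm of the unit `w`: `∂L = ∂w / w` with respect to `x` and all the `t_j`.
This determines `L` up to an additive constant (that may depend on `ε`). -/
def IsLogOf (dx dX : Derivation ℂ K K) (L w : Ser K) : Prop :=
  IsUnit w ∧ w * serDeriv dx L = serDeriv dx w ∧ ∀ k : ℕ, w * dt dX k L = dt dX k w

/-- `φ = ε log q`, where `(1 - Λ⁻¹) log q = log w` (with `log w = L`) and
`ε ∂(log q)/∂t_k = Λ(c_{k+1})` for all `k ≥ 0`. -/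
def IsEpsLogQ (dx dX : Derivation ℂ K K) (v w L φ : Ser K) : Prop :=
  φ - shift dx (-1) φ = eps * L ∧
  ∀ k : ℕ, dt dX k φ = shift dx 1 (todaC (shift dx) v w (k + 1))

/-- `T = ε² log τ`, where `τ` satisfies
`ε² ∂²(log τ)/∂t_i∂t_j = Ω_{i,j}^NLS`, `ε (Λ - 1) ∂(log τ)/∂t_k = Λ(c_{k+1})` and
`(Λ + Λ⁻¹ - 2) log τ = log (q r)`. Here `ε log q = φ` and `r = 1 / (Λ⁻¹ q)`, that is,
`log r = - Λ⁻¹ log q`; as `q / (Λ⁻¹ q) = w`, this means that `q r = w`. -/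
def IsNLSTau (dx dX : Derivation ℂ K K) (v w φ T : Ser K) : Prop :=
  (∀ i j : ℕ, LaurentPolynomial.C (dt dX i (dt dX j T)) = nlsOmegaAt dX φ w i j) ∧
  (∀ k : ℕ, shift dx 1 (dt dX k T) - dt dX k T
    = eps * shift dx 1 (todaC (shift dx) v w (k + 1))) ∧
  shift dx 1 T + shift dx (-1) T - 2 * T = eps * (φ - shift dx (-1) φ)

/-- `T = ε² log τ`, where `τ` is the tau-function of the solution `(v, w)` of the Toda lattice
hierarchy: `ε² ∂²(log τ)/∂t_i∂t_j = Ω_{i,j}`,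
`ε ∂/∂t_i log (τ(x+ε)/τ(x)) = Λ(c_{i+1})` (the coefficient of `λ^{-i-2}` in `Λ(R(λ))₂₁`), and
`τ(x+ε) τ(x-ε) / τ(x)² = w`, where `log w = L`. -/
def IsTodaTau (dx dX : Derivation ℂ K K) (v w L T : Ser K) : Prop :=
  (∀ i j : ℕ, dt dX i (dt dX j T) = todaOmega (shift dx) v w i j) ∧
  (∀ i : ℕ, dt dX i (shift dx 1 T - T)
    = eps * shift dx 1 (todaC (shift dx) v w (i + 1))) ∧
  shift dx 1 T + shift dx (-1) T - 2 * T = eps ^ 2 * L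

end TodaHierarchy

/-! ### Power series in `x` -/

section PowerSeriesInX

variable {F : Type*} [CommRing F] [Algebra ℂ F]

/-- `∂ₓ` on `F[[x]]`. -/
def dxPS (F : Type*) [CommRing F] [Algebra ℂ F] :
    Derivation ℂ (PowerSeries F) (PowerSeries F) :=
  (PowerSeries.derivative F).restrictScalars ℂ

/-- `∂_X` on `F[[x]]`, coefficientwise. -/
def dXPS (dX : Derivation ℂ F F) : Derivation ℂ (PowerSeries F) (PowerSeries F) :=
  mapDeriv dX

/-- The restriction to `x = 0`. -/
def atZero : Ser (PowerSeries F) →+* Ser F := serMap PowerSeries.constantCoeff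

/-- `(v, w)`, a pair of power series in `x`, `t_{>0}` and `ε`, solves the difference system with the
initial data `v = V = ε (∂_X q) / q = ∂_X φ` and `w = W = q r` at `x = 0`, where `q = e^{φ/ε}`. -/
def SolvesInitialValueProblem (dX : Derivation ℂ F F) (φ W : Ser F)
    (v w : Ser (PowerSeries F)) : Prop :=
  IsDifferenceSolution (dxPS F) (dXPS dX) v w ∧ atZero v = dt dX 0 φ ∧ atZero w = W

end PowerSeriesInX

end TodaNLS

end

open Finset.HasAntidiagonal

noncomputable section

namespace TodaNLS

section Operators

variable {R : Type*} [CommRing R] [Algebra ℂ R]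

/-- The operator `∑ᵢ pᵢ (ε d)^i` on `R⟦ε⟧`, for a series `p = ∑ᵢ pᵢ u^i` and a derivation `d`
of `R`. -/
def opSeries (d : Derivation ℂ R R) (p : PowerSeries ℂ) (f : PowerSeries R) : PowerSeries R :=
  PowerSeries.mk fun n => ∑ ij ∈ antidiagonal n,
    PowerSeries.coeff ij.1 p • (⇑d)^[ij.1] (PowerSeries.coeff ij.2 f)

theorem coeff_opSeries (d : Derivation ℂ R R) (p : PowerSeries ℂ) (f : PowerSeries R) (n : ℕ) :
    PowerSeries.coeff n (opSeries d p f) = ∑ ij ∈ antidiagonal n,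
      PowerSeries.coeff ij.1 p • (⇑d)^[ij.1] (PowerSeries.coeff ij.2 f) := by
  simp [opSeries]

theorem iterate_derivation_smul (d : Derivation ℂ R R) (i : ℕ) (c : ℂ) (x : R) :
    (⇑d)^[i] (c • x) = c • (⇑d)^[i] x := by
  induction i generalizing x with
  | zero => rfl
  | succ i ih => rw [Function.iterate_succ_apply, Function.iterate_succ_apply, d.map_smul, ih]

theorem iterate_derivation_sum (d : Derivation ℂ R R) (i : ℕ) {κ : Type*} (s : Finset κ)
    (x : κ → R) : (⇑d)^[i] (∑ k ∈ s, x k) = ∑ k ∈ s, (⇑d)^[i] (x k) := by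
  induction i generalizing x with
  | zero => rfl
  | succ i ih => simp only [Function.iterate_succ_apply, map_sum, ih]

theorem opSeries_add (d : Derivation ℂ R R) (p : PowerSeries ℂ) (f g : PowerSeries R) :
    opSeries d p (f + g) = opSeries d p f + opSeries d p g := by
  ext n
  simp only [coeff_opSeries, map_add, iterate_map_add, smul_add, Finset.sum_add_distrib]

theorem opSeries_add_left (d : Derivation ℂ R R) (p q : PowerSeries ℂ) (f : PowerSeries R) :
    opSeries d (p + q) f = opSeries d p f + opSeries d q f := by
  ext n
  simp only [coeff_opSeries, map_add, add_smul, Finset.sum_add_distrib]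

theorem opSeries_sub (d : Derivation ℂ R R) (p : PowerSeries ℂ) (f g : PowerSeries R) :
    opSeries d p (f - g) = opSeries d p f - opSeries d p g := by
  rw [eq_sub_iff_add_eq, ← opSeries_add, sub_add_cancel]

theorem opSeries_one (d : Derivation ℂ R R) (f : PowerSeries R) : opSeries d 1 f = f := by
  ext n
  rw [coeff_opSeries, Finset.sum_eq_single (0, n)]
  · simp
  · rintro ⟨i, j⟩ h hne
    have hi : i ≠ 0 := by
      rintro rfl
      simp at h
      exact hne (by rw [h])
    simp [PowerSeries.coeff_one, hi]
  · simp

theorem opSeries_mul (d : Derivation ℂ R R) (p q : PowerSeries ℂ) (f : PowerSeries R) :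
    opSeries d (p * q) f = opSeries d p (opSeries d q f) := by
  ext n
  simp only [coeff_opSeries, PowerSeries.coeff_mul, iterate_derivation_sum,
    iterate_derivation_smul, Finset.sum_smul, Finset.smul_sum, ← Function.iterate_add_apply]
  rw [Finset.sum_sigma', Finset.sum_sigma']
  refine Finset.sum_nbij' (fun x => ⟨(x.2.1, x.2.2 + x.1.2), (x.2.2, x.1.2)⟩)
    (fun x => ⟨(x.1.1 + x.2.1, x.2.2), (x.1.1, x.2.1)⟩) ?_ ?_ ?_ ?_ ?_
  · rintro ⟨⟨a, b⟩, ⟨c, e⟩⟩ h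
    simp at h ⊢
    omega
  · rintro ⟨⟨a, b⟩, ⟨c, e⟩⟩ h
    simp at h ⊢
    omega
  · rintro ⟨⟨a, b⟩, ⟨c, e⟩⟩ h
    simp at h
    obtain ⟨h1, rfl⟩ := h
    rfl
  · rintro ⟨⟨a, b⟩, ⟨c, e⟩⟩ h
    simp at h
    obtain ⟨h1, rfl⟩ := h
    rfl
  · rintro ⟨⟨a, b⟩, ⟨c, e⟩⟩ h
    simp at h ⊢
    obtain ⟨h1, rfl⟩ := h
    rw [mul_smul]

theorem opSeries_X (d : Derivation ℂ R R) (f : PowerSeries R) :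
    opSeries d PowerSeries.X f = PowerSeries.X * mapDeriv (σ := Unit) d f := by
  ext n
  rw [coeff_opSeries]
  cases n with
  | zero => simp
  | succ n =>
    rw [PowerSeries.coeff_succ_X_mul, Finset.sum_eq_single (1, n)]
    · simp only [PowerSeries.coeff_one_X, one_smul, Function.iterate_one]
      rfl
    · rintro ⟨i, j⟩ h hne
      have hi : i ≠ 1 := by
        rintro rfl
        simp at h
        exact hne (by rw [show j = n by omega])
      simp [PowerSeries.coeff_X, hi]
    · intro h
      simp [add_comm] at h

theorem opSeries_X_mul_right (d : Derivation ℂ R R) (p : PowerSeries ℂ) (f : PowerSeries R) :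
    opSeries d p (PowerSeries.X * f) = PowerSeries.X * opSeries d p f := by
  ext n
  cases n with
  | zero => simp [coeff_opSeries]
  | succ n =>
    rw [PowerSeries.coeff_succ_X_mul, coeff_opSeries, coeff_opSeries,
      Finset.Nat.sum_antidiagonal_succ']
    simp only [PowerSeries.coeff_succ_X_mul, PowerSeries.coeff_zero_X_mul,
      iterate_map_zero, smul_zero, zero_add]

theorem iterate_derivation_mul (d : Derivation ℂ R R) (n : ℕ) (x y : R) :
    (⇑d)^[n] (x * y) = ∑ ij ∈ antidiagonal n,
      n.choose ij.1 • ((⇑d)^[ij.1] x * (⇑d)^[ij.2] y) := by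
  induction n with
  | zero => simp
  | succ n ih =>
    rw [Finset.sum_antidiagonal_choose_succ_nsmul (fun i j => (⇑d)^[i] x * (⇑d)^[j] y) n,
      Function.iterate_succ_apply', ih, map_sum, ← Finset.sum_add_distrib]
    refine Finset.sum_congr rfl fun ij hij => ?_
    rw [map_nsmul, Derivation.leibniz, smul_eq_mul, smul_eq_mul, nsmul_add,
      ← Function.iterate_succ_apply' d, ← Function.iterate_succ_apply' d,
      mul_comm ((⇑d)^[ij.2] y)]
    rw [← Nat.choose_symm_of_eq_add (mem_antidiagonal.mp hij).symm]

/-- The series `e^{su}`. -/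
def expSeries (s : ℂ) : PowerSeries ℂ := PowerSeries.mk fun n => s ^ n / (n.factorial : ℂ)

theorem expSeries_eq (s : ℂ) :
    expSeries s = PowerSeries.rescale s (PowerSeries.exp ℂ) := by
  ext n
  simp [expSeries, PowerSeries.coeff_rescale, PowerSeries.coeff_exp, div_eq_mul_inv]

theorem expSeries_mul (s t : ℂ) : expSeries s * expSeries t = expSeries (s + t) := by
  simp only [expSeries_eq, PowerSeries.exp_mul_exp_eq_exp_add]

theorem expSeries_zero : expSeries 0 = 1 := by
  ext n
  cases n <;> simp [expSeries, PowerSeries.coeff_one]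

theorem opSeries_expSeries_mul (d : Derivation ℂ R R) (s : ℂ) (f g : PowerSeries R) :
    opSeries d (expSeries s) (f * g) = opSeries d (expSeries s) f * opSeries d (expSeries s) g := by
  have key : ∀ (i : ℕ) (x y : R), (s ^ i / (i.factorial : ℂ)) • (⇑d)^[i] (x * y) =
      ∑ kl ∈ antidiagonal i, ((s ^ kl.1 / (kl.1.factorial : ℂ)) • (⇑d)^[kl.1] x) *
        ((s ^ kl.2 / (kl.2.factorial : ℂ)) • (⇑d)^[kl.2] y) := by
    intro i x y
    rw [iterate_derivation_mul, Finset.smul_sum]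
    refine Finset.sum_congr rfl fun ⟨k, l⟩ h => ?_
    obtain rfl := mem_antidiagonal.mp h
    rw [← Nat.cast_smul_eq_nsmul ℂ, smul_smul, smul_mul_smul_comm]
    congr 1
    have h1 := Nat.add_choose_mul_factorial_mul_factorial k l
    have h2 : ((k + l).factorial : ℂ) ≠ 0 := by exact_mod_cast Nat.factorial_ne_zero _
    have h3 : (k.factorial : ℂ) ≠ 0 := by exact_mod_cast Nat.factorial_ne_zero _
    have h4 : (l.factorial : ℂ) ≠ 0 := by exact_mod_cast Nat.factorial_ne_zero _
    have h5 : ((k + l).choose k : ℂ) * k.factorial * l.factorial = (k + l).factorial := by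
      rw [Nat.choose_symm_add]
      exact_mod_cast h1
    simp only
    rw [pow_add, div_mul_div_comm, div_mul_eq_mul_div, div_eq_div_iff h2 (mul_ne_zero h3 h4), ← h5]
    ring
  ext n
  simp only [coeff_opSeries, PowerSeries.coeff_mul, iterate_derivation_sum, expSeries,
    PowerSeries.coeff_mk, Finset.smul_sum, key, Finset.sum_mul_sum]
  simp only [Finset.sum_sigma']
  refine Finset.sum_nbij'
    (fun x => ⟨(x.2.2.1 + x.2.1.1, x.2.2.2 + x.2.1.2), ⟨(x.2.2.1, x.2.1.1), (x.2.2.2, x.2.1.2)⟩⟩)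
    (fun x => ⟨(x.2.1.1 + x.2.2.1, x.2.1.2 + x.2.2.2), ⟨(x.2.1.2, x.2.2.2),
      (x.2.1.1, x.2.2.1)⟩⟩) ?_ ?_ ?_ ?_ ?_
  · rintro ⟨⟨a, b⟩, ⟨⟨c, e⟩, ⟨k, l⟩⟩⟩ h
    simp at h ⊢
    omega
  · rintro ⟨⟨a, b⟩, ⟨⟨c, e⟩, ⟨k, l⟩⟩⟩ h
    simp at h ⊢
    omega
  · rintro ⟨⟨a, b⟩, ⟨⟨c, e⟩, ⟨k, l⟩⟩⟩ h
    simp at h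
    obtain ⟨h1, rfl, rfl⟩ := h
    rfl
  · rintro ⟨⟨a, b⟩, ⟨⟨c, e⟩, ⟨k, l⟩⟩⟩ h
    simp at h
    obtain ⟨h1, rfl, rfl⟩ := h
    rfl
  · rintro ⟨⟨a, b⟩, ⟨⟨c, e⟩, ⟨k, l⟩⟩⟩ h
    rfl

theorem coeff_mapDeriv (d : Derivation ℂ R R) (f : PowerSeries R) (n : ℕ) :
    PowerSeries.coeff n (mapDeriv (σ := Unit) d f) = d (PowerSeries.coeff n f) := rfl

theorem mvCoeff_mapDeriv {σ : Type*} (d : Derivation ℂ R R) (f : MvPowerSeries σ R)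
    (m : σ →₀ ℕ) :
    MvPowerSeries.coeff m (mapDeriv d f) = d (MvPowerSeries.coeff m f) := rfl

theorem mapDeriv_comm {σ : Type*} {d d' : Derivation ℂ R R} (h : ∀ x, d (d' x) = d' (d x))
    (f : MvPowerSeries σ R) :
    mapDeriv d (mapDeriv d' f) = mapDeriv d' (mapDeriv d f) := by
  ext m
  simp only [mvCoeff_mapDeriv, h]

theorem opSeries_mapDeriv {d d' : Derivation ℂ R R} (h : ∀ x, d' (d x) = d (d' x))
    (p : PowerSeries ℂ) (f : PowerSeries R) :
    opSeries d p (mapDeriv (σ := Unit) d' f) = mapDeriv (σ := Unit) d' (opSeries d p f) := by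
  ext n
  have hi (i : ℕ) (x : R) : d' ((⇑d)^[i] x) = (⇑d)^[i] (d' x) :=
    Function.Semiconj.iterate_right (f := d') h i x
  simp only [coeff_mapDeriv, coeff_opSeries, map_sum, d'.map_smul, hi]

theorem mapDeriv_X_mul (d : Derivation ℂ R R) (f : PowerSeries R) :
    mapDeriv (σ := Unit) d (PowerSeries.X * f) = PowerSeries.X * mapDeriv (σ := Unit) d f := by
  ext n
  rw [coeff_mapDeriv]
  cases n <;> simp [PowerSeries.coeff_succ_X_mul, coeff_mapDeriv]

end Operators

section SerOperators

variable {K : Type*} [CommRing K] [Algebra ℂ K]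

theorem eps_mul_cancel {A : Type*} [CommRing A] {f g : Ser A} (h : eps * f = eps * g) : f = g :=
  PowerSeries.X_mul_cancel h

/-- `∂/∂t_j` on `K⟦t₁, t₂, …⟧`, where `∂/∂t₀` is `∂_X` on the coefficients. -/
def dtCoeff (dX : Derivation ℂ K K) : ℕ → Derivation ℂ (MvPowerSeries ℕ K) (MvPowerSeries ℕ K)
  | 0 => mapDeriv dX
  | k + 1 => (MvPowerSeries.pderiv K k).restrictScalars ℂ

theorem dt_eq_mapDeriv (dX : Derivation ℂ K K) (j : ℕ) :
    dt dX j = mapDeriv (σ := Unit) (dtCoeff dX j) := by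
  cases j <;> rfl

theorem coeff_dt (dX : Derivation ℂ K K) (j n : ℕ) (f : Ser K) :
    PowerSeries.coeff n (dt dX j f) = dtCoeff dX j (PowerSeries.coeff n f) := by
  rw [dt_eq_mapDeriv, coeff_mapDeriv]

theorem coeff_dtCoeff_zero (dX : Derivation ℂ K K) (f : MvPowerSeries ℕ K) (m : ℕ →₀ ℕ) :
    MvPowerSeries.coeff m (dtCoeff dX 0 f) = dX (MvPowerSeries.coeff m f) := rfl

theorem coeff_dtCoeff_succ (dX : Derivation ℂ K K) (k : ℕ) (f : MvPowerSeries ℕ K)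
    (m : ℕ →₀ ℕ) :
    MvPowerSeries.coeff m (dtCoeff dX (k + 1) f) =
      MvPowerSeries.coeff (m + Finsupp.single k 1) f * ((m k : K) + 1) :=
  MvPowerSeries.coeff_pderiv f m

theorem derivation_mul_natCast_add_one (d : Derivation ℂ K K) (x : K) (n : ℕ) :
    d (x * ((n : K) + 1)) = d x * ((n : K) + 1) := by
  have : d ((n : K) + 1) = 0 := by
    rw [map_add, d.map_natCast, d.map_one_eq_zero, add_zero]
  rw [d.leibniz, this, smul_zero, zero_add, smul_eq_mul, mul_comm]

theorem dtCoeff_mapDeriv {dx dX : Derivation ℂ K K} (h : ∀ g, dx (dX g) = dX (dx g)) (j : ℕ)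
    (f : MvPowerSeries ℕ K) :
    dtCoeff dX j (mapDeriv dx f) = mapDeriv dx (dtCoeff dX j f) := by
  ext m
  cases j with
  | zero => simp only [coeff_dtCoeff_zero, mvCoeff_mapDeriv, h]
  | succ k =>
    simp only [coeff_dtCoeff_succ, mvCoeff_mapDeriv, derivation_mul_natCast_add_one]

theorem dtCoeff_comm (dX : Derivation ℂ K K) (i j : ℕ) (f : MvPowerSeries ℕ K) :
    dtCoeff dX i (dtCoeff dX j f) = dtCoeff dX j (dtCoeff dX i f) := by
  have h0 : ∀ i, dtCoeff dX i (dtCoeff dX 0 f) = dtCoeff dX 0 (dtCoeff dX i f) := fun i =>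
    dtCoeff_mapDeriv (fun _ => rfl) i f
  match i, j with
  | i, 0 => exact h0 i
  | 0, j + 1 => exact (h0 _).symm
  | i + 1, j + 1 =>
    ext m
    simp only [coeff_dtCoeff_succ]
    by_cases hij : i = j
    · rw [hij]
    · simp only [Finsupp.add_apply, Finsupp.single_apply, hij, Ne.symm hij, if_false, add_zero]
      rw [add_right_comm, mul_right_comm]

theorem dt_comm (dX : Derivation ℂ K K) (i j : ℕ) (f : Ser K) :
    dt dX i (dt dX j f) = dt dX j (dt dX i f) := by
  simp only [dt_eq_mapDeriv]
  exact mapDeriv_comm (dtCoeff_comm dX i j) f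

theorem dt_eps_mul (dX : Derivation ℂ K K) (j : ℕ) (f : Ser K) :
    dt dX j (eps * f) = eps * dt dX j f := by
  simp only [dt_eq_mapDeriv, eps]
  exact mapDeriv_X_mul _ f

theorem shift_eq_opSeries (dx : Derivation ℂ K K) (s : ℤ) (f : Ser K) :
    shift dx s f = opSeries (mapDeriv dx) (expSeries s) f := by
  ext1 n
  rw [coeff_opSeries, shift, PowerSeries.coeff_mk, Finset.Nat.sum_antidiagonal_eq_sum_range_succ_mk]
  simp [expSeries]

theorem shift_shift (dx : Derivation ℂ K K) (s t : ℤ) (f : Ser K) :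
    shift dx s (shift dx t f) = shift dx (s + t) f := by
  simp only [shift_eq_opSeries, ← opSeries_mul, expSeries_mul, Int.cast_add]

theorem shift_zero (dx : Derivation ℂ K K) (f : Ser K) : shift dx 0 f = f := by
  rw [shift_eq_opSeries, Int.cast_zero, expSeries_zero, opSeries_one]

/-- The shift `Λ` as a ring automorphism of `Ser K`. -/
def shiftEquiv (dx : Derivation ℂ K K) : Ser K ≃+* Ser K where
  toFun := shift dx 1
  invFun := shift dx (-1)
  left_inv f := by rw [shift_shift]; exact shift_zero dx f
  right_inv f := by rw [shift_shift]; exact shift_zero dx f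
  map_mul' f g := by simp only [shift_eq_opSeries, opSeries_expSeries_mul]
  map_add' f g := by simp only [shift_eq_opSeries, opSeries_add]

theorem shiftEquiv_apply (dx : Derivation ℂ K K) (f : Ser K) : shiftEquiv dx f = shift dx 1 f := rfl

theorem shiftEquiv_symm_apply (dx : Derivation ℂ K K) (f : Ser K) :
    (shiftEquiv dx).symm f = shift dx (-1) f := rfl

theorem shift_eps_mul (dx : Derivation ℂ K K) (s : ℤ) (f : Ser K) :
    shift dx s (eps * f) = eps * shift dx s f := by
  simp only [shift_eq_opSeries, eps, opSeries_X_mul_right]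

theorem opSeries_dt {dx dX : Derivation ℂ K K} (h : ∀ g, dx (dX g) = dX (dx g))
    (p : PowerSeries ℂ) (j : ℕ) (f : Ser K) :
    opSeries (mapDeriv dx) p (dt dX j f) = dt dX j (opSeries (mapDeriv dx) p f) := by
  rw [dt_eq_mapDeriv]
  exact opSeries_mapDeriv (dtCoeff_mapDeriv h j) p f

theorem opSeries_serDeriv (dx : Derivation ℂ K K) (p : PowerSeries ℂ) (f : Ser K) :
    opSeries (mapDeriv dx) p (serDeriv dx f) = serDeriv dx (opSeries (mapDeriv dx) p f) :=
  opSeries_mapDeriv (fun _ => rfl) p f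

theorem shift_dt {dx dX : Derivation ℂ K K} (h : ∀ g, dx (dX g) = dX (dx g))
    (s : ℤ) (j : ℕ) (f : Ser K) :
    shift dx s (dt dX j f) = dt dX j (shift dx s f) := by
  simp only [shift_eq_opSeries, opSeries_dt h]

/-- The series `(e^u - 1) / u`. -/
def expQuot : PowerSeries ℂ := PowerSeries.mk fun n => 1 / ((n + 1).factorial : ℂ)

theorem expSeries_one_eq : expSeries 1 = 1 + PowerSeries.X * expQuot := by
  ext n
  cases n with
  | zero => simp [expSeries, expQuot]
  | succ n => simp [expSeries, expQuot, PowerSeries.coeff_succ_X_mul, PowerSeries.coeff_one]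

theorem exists_expQuot_inv : ∃ p : PowerSeries ℂ, expQuot * p = 1 := by
  have : IsUnit expQuot := by
    rw [PowerSeries.isUnit_iff_constantCoeff]
    simp [expQuot]
  obtain ⟨u, hu⟩ := this
  exact ⟨↑u⁻¹, by rw [← hu, Units.mul_inv]⟩

/-- `Λ - 1 = ε ∂ₓ κ` with `κ = (e^{ε ∂ₓ} - 1) / (ε ∂ₓ)`. -/
theorem shift_sub_self (dx : Derivation ℂ K K) (f : Ser K) :
    shift dx 1 f - f = eps * serDeriv dx (opSeries (mapDeriv dx) expQuot f) := by
  rw [shift_eq_opSeries, Int.cast_one, expSeries_one_eq, opSeries_add_left, opSeries_one,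
    add_sub_cancel_left, opSeries_mul, opSeries_X]
  rfl

theorem serMap_eps {A K' : Type*} [CommRing A] [CommRing K'] (F : A →+* K') :
    serMap F eps = eps := by
  simp [serMap, eps]

theorem coeff_serMap {A K' : Type*} [CommRing A] [CommRing K'] (F : A →+* K') (f : Ser A) (n : ℕ) :
    PowerSeries.coeff n (serMap F f) = MvPowerSeries.map F (PowerSeries.coeff n f) := by
  simp [serMap]

theorem serMap_dt {K' : Type*} [CommRing K'] [Algebra ℂ K'] (F : K →+* K')
    {dX : Derivation ℂ K K} {dX' : Derivation ℂ K' K'} (h : ∀ g, F (dX g) = dX' (F g))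
    (j : ℕ) (f : Ser K) : serMap F (dt dX j f) = dt dX' j (serMap F f) := by
  ext n m
  rw [coeff_serMap, coeff_dt, coeff_dt, coeff_serMap, MvPowerSeries.coeff_map]
  cases j with
  | zero => simp only [coeff_dtCoeff_zero, h, MvPowerSeries.coeff_map]
  | succ k => simp [coeff_dtCoeff_succ]

theorem serMap_shift {K' : Type*} [CommRing K'] [Algebra ℂ K'] (F : K →ₐ[ℂ] K')
    {dx : Derivation ℂ K K} {dx' : Derivation ℂ K' K'} (h : ∀ g, F (dx g) = dx' (F g))
    (s : ℤ) (f : Ser K) :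
    serMap (F : K →+* K') (shift dx s f) = shift dx' s (serMap (F : K →+* K') f) := by
  ext n m
  rw [coeff_serMap, shift_eq_opSeries, shift_eq_opSeries, coeff_opSeries, map_sum,
    map_sum, coeff_opSeries, map_sum]
  refine Finset.sum_congr rfl fun ij _ => ?_
  have hi : ∀ (i : ℕ) (x : MvPowerSeries ℕ K), MvPowerSeries.map (F : K →+* K')
      ((⇑(mapDeriv dx))^[i] x) = (⇑(mapDeriv dx'))^[i] (MvPowerSeries.map (F : K →+* K') x) := by
    refine Function.Semiconj.iterate_right fun x => ?_
    ext m
    simp [mvCoeff_mapDeriv, h]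
  rw [coeff_serMap, ← hi]
  simp only [MvPowerSeries.coeff_map]
  exact map_smul F _ _

end SerOperators

section Resolvent

variable {S : Type*} [CommRing S]

/-- The coefficientwise extension of an automorphism of `S` to `S⟦z⟧`. -/
abbrev seriesShift (Λ : S ≃+* S) : PowerSeries S →+* PowerSeries S :=
  PowerSeries.map (Λ : S →+* S)

theorem coeff_seriesShift (Λ : S ≃+* S) (f : PowerSeries S) (n : ℕ) :
    PowerSeries.coeff n (seriesShift Λ f) = Λ (PowerSeries.coeff n f) := by
  simp

theorem constantCoeff_seriesShift (Λ : S ≃+* S) (f : PowerSeries S) :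
    PowerSeries.constantCoeff (seriesShift Λ f) = Λ (PowerSeries.constantCoeff f) := by
  simp only [← PowerSeries.coeff_zero_eq_constantCoeff_apply, coeff_seriesShift]

/-- The scalar form of the equations satisfied by the entries `α, γ` of the basic matrix resolvent
of `Λ + [[v - λ, w], [-1, 0]]`, as power series in `z = λ⁻¹`. -/
structure IsTodaResolvent (Λ : S ≃+* S) (v w : S) (α γ : PowerSeries S) : Prop where
  constantCoeff_fst : PowerSeries.constantCoeff α = 0
  linear : (1 - PowerSeries.X * PowerSeries.C v) * seriesShift Λ γ
    = PowerSeries.X * (1 + α + seriesShift Λ α)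
  quadratic : α + α ^ 2 = PowerSeries.C w * γ * seriesShift Λ γ

theorem coeff_mul_mem_of_constantCoeff_eq_zero {I : Ideal S} {A B : PowerSeries S} {n : ℕ}
    (hA : PowerSeries.constantCoeff A = 0) (hB : ∀ k < n, PowerSeries.coeff k B ∈ I) :
    PowerSeries.coeff n (A * B) ∈ I := by
  rw [PowerSeries.coeff_mul]
  refine I.sum_mem fun ⟨i, j⟩ hij => ?_
  have hij := mem_antidiagonal.mp hij
  rcases Nat.eq_zero_or_pos i with rfl | hi
  · simp [hA]
  · exact I.mul_mem_left _ (hB j (by simp at hij; omega))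

namespace IsTodaResolvent

variable {Λ : S ≃+* S} {v w : S} {α γ : PowerSeries S}

theorem constantCoeff_snd (h : IsTodaResolvent Λ v w α γ) :
    PowerSeries.constantCoeff γ = 0 := by
  have := congrArg PowerSeries.constantCoeff h.linear
  simpa [constantCoeff_seriesShift] using this

theorem isUnit_aux (h : IsTodaResolvent Λ v w α γ) : IsUnit (1 + α + seriesShift Λ α) := by
  rw [PowerSeries.isUnit_iff_constantCoeff]
  simp [constantCoeff_seriesShift, h.constantCoeff_fst]

theorem eq_zero_of_mul_eq_zero (h : IsTodaResolvent Λ v w α γ) {y : PowerSeries S}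
    (hy : seriesShift Λ γ * y = 0) : y = 0 := by
  have h1 : PowerSeries.X * ((1 + α + seriesShift Λ α) * y) = PowerSeries.X * 0 := by
    rw [← mul_assoc, ← h.linear, mul_assoc, hy, mul_zero, mul_zero]
  have h2 := PowerSeries.X_mul_cancel h1
  exact (h.isUnit_aux.mul_right_eq_zero).mp h2

theorem linear_fst (h : IsTodaResolvent Λ v w α γ) :
    (1 - PowerSeries.X * PowerSeries.C v) * (seriesShift Λ α - α)
      = PowerSeries.X * (PowerSeries.C (Λ w) * seriesShift Λ (seriesShift Λ γ)
        - PowerSeries.C w * γ) := by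
  have h2 := congrArg (seriesShift Λ) h.quadratic
  simp only [map_add, map_mul, map_pow, PowerSeries.map_C, RingHom.coe_coe] at h2
  rw [← sub_eq_zero]
  apply h.eq_zero_of_mul_eq_zero
  linear_combination (seriesShift Λ α - α) * h.linear + PowerSeries.X * h2
    - PowerSeries.X * h.quadratic

theorem mem_of_linearized (h : IsTodaResolvent Λ v w α γ) {I : Ideal S}
    (hI : ∀ x, x ∈ I ↔ Λ x ∈ I) {N₁ N₃ : PowerSeries S}
    (h₁ : ∀ n, PowerSeries.coeff n ((1 - PowerSeries.X * PowerSeries.C v) * seriesShift Λ N₃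
      - PowerSeries.X * (N₁ + seriesShift Λ N₁)) ∈ I)
    (h₂ : ∀ n, PowerSeries.coeff n ((1 + 2 * α) * N₁
      - PowerSeries.C w * (N₃ * seriesShift Λ γ + γ * seriesShift Λ N₃)) ∈ I) (n : ℕ) :
    PowerSeries.coeff n N₁ ∈ I ∧ PowerSeries.coeff n N₃ ∈ I := by
  induction n using Nat.strong_induction_on with
  | _ n ih =>
    have hs : ∀ {N : PowerSeries S}, (∀ k < n, PowerSeries.coeff k N ∈ I) →
        ∀ k < n, PowerSeries.coeff k (seriesShift Λ N) ∈ I := fun hN k hk => by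
      rw [coeff_seriesShift, ← hI]
      exact hN k hk
    have i1 : ∀ k < n, PowerSeries.coeff k N₁ ∈ I := fun k hk => (ih k hk).1
    have i3 : ∀ k < n, PowerSeries.coeff k N₃ ∈ I := fun k hk => (ih k hk).2
    have hX : PowerSeries.constantCoeff (PowerSeries.X : PowerSeries S) = 0 := by simp
    have hXv : PowerSeries.constantCoeff (PowerSeries.X * PowerSeries.C v : PowerSeries S) = 0 := by
      simp
    have h2α : PowerSeries.constantCoeff (2 * α) = 0 := by
      simp [h.constantCoeff_fst]
    have hγ : PowerSeries.constantCoeff (PowerSeries.C w * γ) = 0 := by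
      simp [h.constantCoeff_snd]
    have hγ' : PowerSeries.constantCoeff (PowerSeries.C w * seriesShift Λ γ) = 0 := by
      simp [constantCoeff_seriesShift, h.constantCoeff_snd]
    constructor
    · have e : N₁ = ((1 + 2 * α) * N₁
          - PowerSeries.C w * (N₃ * seriesShift Λ γ + γ * seriesShift Λ N₃))
          - 2 * α * N₁ + PowerSeries.C w * seriesShift Λ γ * N₃
          + PowerSeries.C w * γ * seriesShift Λ N₃ := by ring
      rw [e, map_add, map_add, map_sub]
      exact I.add_mem (I.add_mem (I.sub_mem (h₂ n)
        (coeff_mul_mem_of_constantCoeff_eq_zero h2α i1))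
        (coeff_mul_mem_of_constantCoeff_eq_zero hγ' i3))
        (coeff_mul_mem_of_constantCoeff_eq_zero hγ (hs i3))
    · have e : seriesShift Λ N₃ = ((1 - PowerSeries.X * PowerSeries.C v) * seriesShift Λ N₃
          - PowerSeries.X * (N₁ + seriesShift Λ N₁))
          + PowerSeries.X * PowerSeries.C v * seriesShift Λ N₃
          + PowerSeries.X * N₁ + PowerSeries.X * seriesShift Λ N₁ := by ring
      rw [hI, ← coeff_seriesShift, e, map_add, map_add, map_add]
      exact I.add_mem (I.add_mem (I.add_mem (h₁ n)
        (coeff_mul_mem_of_constantCoeff_eq_zero hXv (hs i3)))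
        (coeff_mul_mem_of_constantCoeff_eq_zero hX i1))
        (coeff_mul_mem_of_constantCoeff_eq_zero hX (hs i1))

variable [Algebra ℂ S]

theorem mapDeriv_C (D : Derivation ℂ S S) (x : S) :
    mapDeriv (σ := Unit) D (PowerSeries.C x) = PowerSeries.C (D x) := by
  ext n
  rw [coeff_mapDeriv, PowerSeries.coeff_C, PowerSeries.coeff_C]
  split_ifs <;> simp

theorem mapDeriv_seriesShift {D : Derivation ℂ S S} (hD : ∀ x, D (Λ x) = Λ (D x))
    (f : PowerSeries S) :
    mapDeriv (σ := Unit) D (seriesShift Λ f) = seriesShift Λ (mapDeriv (σ := Unit) D f) := by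
  ext n
  simp only [coeff_mapDeriv, coeff_seriesShift, hD]

/-- The flow of the matrix resolvent along the derivation `D = ε ∂_X`, modulo an ideal modulo which
the difference system holds. -/
theorem first_flow_mem (h : IsTodaResolvent Λ v w α γ) {I : Ideal S}
    (hI : ∀ x, x ∈ I ↔ Λ x ∈ I) {D : Derivation ℂ S S} (hD : ∀ x, D (Λ x) = Λ (D x))
    (hv : D v - (Λ w - w) ∈ I) (hw : D w - w * (v - Λ.symm v) ∈ I) (n : ℕ) :
    D (PowerSeries.coeff n α) - w * (Λ (PowerSeries.coeff n γ) - PowerSeries.coeff n γ) ∈ I ∧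
    D (Λ (PowerSeries.coeff n γ)) - (Λ (PowerSeries.coeff n α) - PowerSeries.coeff n α) ∈ I := by
  have hs : ∀ f, seriesShift Λ (seriesShift Λ.symm f) = f := fun f => by
    ext n; simp only [coeff_seriesShift, RingEquiv.apply_symm_apply]
  set d := mapDeriv (σ := Unit) D with hd
  set N₁ := d α - PowerSeries.C w * (seriesShift Λ γ - γ) with hN₁
  set N₃ := d γ - (α - seriesShift Λ.symm α) with hN₃
  have hΛN₃ : seriesShift Λ N₃ = d (seriesShift Λ γ) - (seriesShift Λ α - α) := by
    rw [hN₃, map_sub, map_sub, hs, hd, mapDeriv_seriesShift hD]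
  have hΛN₁ : seriesShift Λ N₁ = d (seriesShift Λ α)
      - PowerSeries.C (Λ w) * (seriesShift Λ (seriesShift Λ γ) - seriesShift Λ γ) := by
    rw [hN₁, map_sub, hd, mapDeriv_seriesShift hD, map_mul, map_sub, PowerSeries.map_C]
    rfl
  have hdX : d PowerSeries.X = 0 := by
    have := mapDeriv_X_mul D 1
    simpa [hd] using this
  have hl := congrArg d h.linear
  have hq := congrArg d h.quadratic
  have hdv : d (PowerSeries.C v) = PowerSeries.C (D v) := mapDeriv_C D v
  have hdw : d (PowerSeries.C w) = PowerSeries.C (D w) := mapDeriv_C D w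
  simp only [Derivation.leibniz, Derivation.leibniz_pow, map_add, map_sub, smul_eq_mul, hdX,
    hdv, hdw, Derivation.map_one_eq_zero, nsmul_eq_mul] at hl hq
  -- The linear equation shifted back by `Λ⁻¹`.
  have hls : (1 - PowerSeries.X * PowerSeries.C (Λ.symm v)) * γ
      = PowerSeries.X * (1 + seriesShift Λ.symm α + α) := by
    have hs' : ∀ f, seriesShift Λ.symm (seriesShift Λ f) = f := fun f => by
      ext n; simp only [coeff_seriesShift, RingEquiv.symm_apply_apply]
    have := congrArg (seriesShift Λ.symm) h.linear
    simpa only [map_mul, map_sub, map_add, map_one, hs', PowerSeries.map_X, PowerSeries.map_C,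
      RingHom.coe_coe] using this
  have key := h.mem_of_linearized hI (N₁ := N₁) (N₃ := N₃) (fun n => ?_) (fun n => ?_) n
  · refine ⟨by simpa [hN₁, hd, coeff_mapDeriv] using key.1, ?_⟩
    have := (hI _).mp key.2
    rw [← coeff_seriesShift, hΛN₃] at this
    simpa [hd, coeff_mapDeriv] using this
  · have e : (1 - PowerSeries.X * PowerSeries.C v) * seriesShift Λ N₃
        - PowerSeries.X * (N₁ + seriesShift Λ N₁)
        = PowerSeries.C (D v - (Λ w - w)) * (PowerSeries.X * seriesShift Λ γ) := by
      have h3 := h.linear_fst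
      rw [hΛN₃, hΛN₁, hN₁]
      simp only [map_sub]
      linear_combination hl - h3
    rw [e, PowerSeries.coeff_C_mul]
    exact I.mul_mem_right _ hv
  · have e : (1 + 2 * α) * N₁
        - PowerSeries.C w * (N₃ * seriesShift Λ γ + γ * seriesShift Λ N₃)
        = PowerSeries.C (D w - w * (v - Λ.symm v)) * (γ * seriesShift Λ γ) := by
      apply PowerSeries.X_mul_cancel
      rw [hΛN₃, hN₁, hN₃]
      simp only [map_sub, map_mul]
      linear_combination PowerSeries.X * hq - PowerSeries.C w * γ * h.linear
        + PowerSeries.C w * seriesShift Λ γ * hls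
    rw [e, PowerSeries.coeff_C_mul]
    exact I.mul_mem_right _ hw

end IsTodaResolvent

end Resolvent

theorem sum_fin_eq_sum_antidiagonal {M : Type*} [AddCommMonoid M] (f : ℕ → ℕ → M) (k : ℕ) :
    ∑ i : Fin (k + 1), f i.1 (k - i.1) = ∑ ij ∈ antidiagonal k, f ij.1 ij.2 := by
  rw [Finset.Nat.sum_antidiagonal_eq_sum_range_succ f, Finset.sum_range]

section TodaRecursion

variable {S : Type*} [CommRing S] (sh : ℤ → S → S) (v w : S)

theorem todaA_zero : todaA sh v w 0 = 0 := by rw [todaA, todaCoeff]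

theorem todaC_zero : todaC sh v w 0 = 1 := by rw [todaC, todaCoeff]

theorem todaA_succ (k : ℕ) : todaA sh v w (k + 1) = ∑ ij ∈ antidiagonal k,
    (w * todaC sh v w ij.1 * sh 1 (todaC sh v w ij.2)
      - todaA sh v w ij.1 * todaA sh v w ij.2) := by
  rw [← sum_fin_eq_sum_antidiagonal fun i j => w * todaC sh v w i * sh 1 (todaC sh v w j)
      - todaA sh v w i * todaA sh v w j]
  conv_lhs => rw [todaA, todaCoeff]
  rfl

theorem todaC_succ (k : ℕ) : todaC sh v w (k + 1) =
    sh (-1) v * todaC sh v w k + todaA sh v w k + sh (-1) (todaA sh v w k) := by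
  conv_lhs => rw [todaC, todaCoeff]
  rfl

/-- The series `α` in `z = λ⁻¹`. -/
def todaAlpha : PowerSeries S := PowerSeries.X * PowerSeries.mk (todaA sh v w)

/-- The series `γ` in `z = λ⁻¹`. -/
def todaGamma : PowerSeries S := PowerSeries.X * PowerSeries.mk (todaC sh v w)

theorem coeff_succ_todaAlpha (n : ℕ) :
    PowerSeries.coeff (n + 1) (todaAlpha sh v w) = todaA sh v w n := by
  rw [todaAlpha, PowerSeries.coeff_succ_X_mul, PowerSeries.coeff_mk]

theorem coeff_succ_todaGamma (n : ℕ) :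
    PowerSeries.coeff (n + 1) (todaGamma sh v w) = todaC sh v w n := by
  rw [todaGamma, PowerSeries.coeff_succ_X_mul, PowerSeries.coeff_mk]

variable {sh v w}

theorem isTodaResolvent {Λ : S ≃+* S} (h₁ : ∀ f, sh 1 f = Λ f) (h₂ : ∀ f, sh (-1) f = Λ.symm f) :
    IsTodaResolvent Λ v w (todaAlpha sh v w) (todaGamma sh v w) where
  constantCoeff_fst := by simp [todaAlpha]
  linear := by
    have hX : seriesShift Λ (todaGamma sh v w)
        = PowerSeries.X * seriesShift Λ (PowerSeries.mk (todaC sh v w)) := by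
      rw [todaGamma, map_mul, PowerSeries.map_X]
    rw [hX, mul_left_comm]
    congr 1
    ext n
    rw [sub_mul, one_mul, mul_assoc, map_sub, map_add, map_add]
    cases n with
    | zero => simp [todaC_zero, todaAlpha, constantCoeff_seriesShift]
    | succ n =>
      rw [PowerSeries.coeff_succ_X_mul, PowerSeries.coeff_C_mul, coeff_seriesShift,
        coeff_seriesShift, coeff_seriesShift, coeff_succ_todaAlpha, PowerSeries.coeff_mk,
        PowerSeries.coeff_mk, todaC_succ]
      simp [h₂, PowerSeries.coeff_one]
      ring
  quadratic := by
    have hX : seriesShift Λ (todaGamma sh v w)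
        = PowerSeries.X * seriesShift Λ (PowerSeries.mk (todaC sh v w)) := by
      rw [todaGamma, map_mul, PowerSeries.map_X]
    rw [hX, todaAlpha, todaGamma, ← sub_eq_zero]
    have : PowerSeries.X * (PowerSeries.mk (todaA sh v w) - PowerSeries.X *
        (PowerSeries.C w * PowerSeries.mk (todaC sh v w)
          * seriesShift Λ (PowerSeries.mk (todaC sh v w))
          - PowerSeries.mk (todaA sh v w) * PowerSeries.mk (todaA sh v w))) = 0 := by
      convert mul_zero _
      ext n
      cases n with
      | zero => simp [todaA_zero]
      | succ n =>
        rw [map_sub, PowerSeries.coeff_succ_X_mul, PowerSeries.coeff_mk, todaA_succ, mul_assoc,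
          map_sub, PowerSeries.coeff_C_mul, PowerSeries.coeff_mul, PowerSeries.coeff_mul,
          Finset.mul_sum, ← Finset.sum_sub_distrib, map_zero, sub_eq_zero]
        refine Finset.sum_congr rfl fun ij _ => ?_
        simp [h₁, mul_assoc]
    linear_combination this

end TodaRecursion

section Jet

variable {S : Type*} [CommRing S]

/-- The coefficients `(A_j, B_j / q, -C_j / r · w)` of the basic matrix resolvent of the NLS
hierarchy, up to powers of `2`, in terms of `V = D(q) / q` and `W = q r`. -/
def jetCoeff (D : S → S) (V W : S) : ℕ → S × S × S
  | 0 => (0, 1, W)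
  | k + 1 =>
    (∑ i : Fin (k + 1), ((jetCoeff D V W i.1).2.1 * (jetCoeff D V W (k - i.1)).2.2
        - (jetCoeff D V W i.1).1 * (jetCoeff D V W (k - i.1)).1),
      V * (jetCoeff D V W k).2.1 + D (jetCoeff D V W k).2.1 + 2 * (jetCoeff D V W k).1,
      V * (jetCoeff D V W k).2.2 - D (jetCoeff D V W k).2.2 + 2 * W * (jetCoeff D V W k).1)
termination_by k => k

variable (D : S → S) (V W : S)

theorem jetCoeff_zero : jetCoeff D V W 0 = (0, 1, W) := by rw [jetCoeff]

theorem jetCoeff_succ_fst (k : ℕ) : (jetCoeff D V W (k + 1)).1 = ∑ ij ∈ antidiagonal k,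
    ((jetCoeff D V W ij.1).2.1 * (jetCoeff D V W ij.2).2.2
      - (jetCoeff D V W ij.1).1 * (jetCoeff D V W ij.2).1) := by
  rw [← sum_fin_eq_sum_antidiagonal fun i j => (jetCoeff D V W i).2.1 * (jetCoeff D V W j).2.2
      - (jetCoeff D V W i).1 * (jetCoeff D V W j).1]
  conv_lhs => rw [jetCoeff]

theorem jetCoeff_succ_snd (k : ℕ) : (jetCoeff D V W (k + 1)).2 =
    (V * (jetCoeff D V W k).2.1 + D (jetCoeff D V W k).2.1 + 2 * (jetCoeff D V W k).1,
      V * (jetCoeff D V W k).2.2 - D (jetCoeff D V W k).2.2 + 2 * W * (jetCoeff D V W k).1) := by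
  conv_lhs => rw [jetCoeff]

end Jet

section Relations

variable {S S' : Type*} [CommRing S] [CommRing S']

/-- A relation between two rings that is compatible with the ring operations. -/
structure IsRingRel (r : S → S' → Prop) : Prop where
  zero : r 0 0
  one : r 1 1
  add : ∀ {x y x' y'}, r x x' → r y y' → r (x + y) (x' + y')
  sub : ∀ {x y x' y'}, r x x' → r y y' → r (x - y) (x' - y')
  mul : ∀ {x y x' y'}, r x x' → r y y' → r (x * y) (x' * y')

theorem IsRingRel.sum {r : S → S' → Prop} (hr : IsRingRel r) {κ : Type*} (s : Finset κ)
    {f : κ → S} {g : κ → S'} (h : ∀ i ∈ s, r (f i) (g i)) :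
    r (∑ i ∈ s, f i) (∑ i ∈ s, g i) := by
  classical
  induction s using Finset.induction_on with
  | empty => simpa using hr.zero
  | insert a s ha ih =>
    rw [Finset.sum_insert ha, Finset.sum_insert ha]
    exact hr.add (h a (Finset.mem_insert_self a s))
      (ih fun i hi => h i (Finset.mem_insert_of_mem hi))

theorem isRingRel_hom (F : S →+* S') : IsRingRel fun x y => F x = y where
  zero := map_zero F
  one := map_one F
  add := by rintro _ _ _ _ rfl rfl; exact map_add F _ _
  sub := by rintro _ _ _ _ rfl rfl; exact map_sub F _ _
  mul := by rintro _ _ _ _ rfl rfl; exact map_mul F _ _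

theorem isRingRel_ideal (I : Ideal S) : IsRingRel fun x y => x - y ∈ I where
  zero := by simp
  one := by simp
  add {x y x' y'} hx hy := by
    have := I.add_mem hx hy
    rwa [show x + y - (x' + y') = x - x' + (y - y') by ring]
  sub {x y x' y'} hx hy := by
    have := I.sub_mem hx hy
    rwa [show x - y - (x' - y') = x - x' - (y - y') by ring]
  mul {x y x' y'} hx hy := by
    have := I.add_mem (I.mul_mem_right y hx) (I.mul_mem_left x' hy)
    rwa [show x * y - x' * y' = (x - x') * y + x' * (y - y') by ring]

theorem IsRingRel.todaCoeff {r : S → S' → Prop} (hr : IsRingRel r) {sh : ℤ → S → S}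
    {sh' : ℤ → S' → S'} (hsh : ∀ s x y, r x y → r (sh s x) (sh' s y)) {v w : S} {v' w' : S'}
    (hv : r v v') (hw : r w w') (k : ℕ) :
    r (todaA sh v w k) (todaA sh' v' w' k) ∧ r (todaC sh v w k) (todaC sh' v' w' k) := by
  induction k using Nat.strong_induction_on with
  | _ k ih =>
    cases k with
    | zero =>
      simp only [todaA_zero, todaC_zero]
      exact ⟨hr.zero, hr.one⟩
    | succ k =>
      obtain ⟨ha, hc⟩ := ih k (Nat.lt_succ_self k)
      refine ⟨?_, ?_⟩
      · rw [todaA_succ, todaA_succ]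
        refine hr.sum _ fun ij hij => ?_
        have hij := mem_antidiagonal.mp hij
        obtain ⟨ha₁, hc₁⟩ := ih ij.1 (by omega)
        obtain ⟨ha₂, hc₂⟩ := ih ij.2 (by omega)
        exact hr.sub (hr.mul (hr.mul hw hc₁) (hsh _ _ _ hc₂)) (hr.mul ha₁ ha₂)
      · rw [todaC_succ, todaC_succ]
        exact hr.add (hr.add (hr.mul (hsh _ _ _ hv) hc) ha) (hsh _ _ _ ha)

theorem IsRingRel.jetCoeff {r : S → S' → Prop} (hr : IsRingRel r) {D : S → S}
    {D' : S' → S'} (hD : ∀ x y, r x y → r (D x) (D' y)) {V W : S} {V' W' : S'}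
    (hV : r V V') (hW : r W W') (k : ℕ) :
    r (jetCoeff D V W k).1 (jetCoeff D' V' W' k).1 ∧
    r (jetCoeff D V W k).2.1 (jetCoeff D' V' W' k).2.1 ∧
    r (jetCoeff D V W k).2.2 (jetCoeff D' V' W' k).2.2 := by
  induction k using Nat.strong_induction_on with
  | _ k ih =>
    cases k with
    | zero =>
      simp only [jetCoeff_zero]
      exact ⟨hr.zero, hr.one, hW⟩
    | succ k =>
      obtain ⟨ha, hg, hh⟩ := ih k (Nat.lt_succ_self k)
      have h2 : r 2 2 := by
        have := hr.add hr.one hr.one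
        rwa [one_add_one_eq_two, one_add_one_eq_two] at this
      refine ⟨?_, ?_, ?_⟩
      · rw [jetCoeff_succ_fst, jetCoeff_succ_fst]
        refine hr.sum _ fun ij hij => ?_
        have hij := mem_antidiagonal.mp hij
        obtain ⟨ha₁, hg₁, -⟩ := ih ij.1 (by omega)
        obtain ⟨ha₂, -, hh₂⟩ := ih ij.2 (by omega)
        exact hr.sub (hr.mul hg₁ hh₂) (hr.mul ha₁ ha₂)
      · rw [jetCoeff_succ_snd, jetCoeff_succ_snd]
        exact hr.add (hr.add (hr.mul hV hg) (hD _ _ hg)) (hr.mul h2 ha)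
      · rw [jetCoeff_succ_snd, jetCoeff_succ_snd]
        exact hr.add (hr.sub (hr.mul hV hh) (hD _ _ hh)) (hr.mul (hr.mul h2 hW) ha)

end Relations

section JetToda

variable {S : Type*} [CommRing S] [Algebra ℂ S]

/-- For a solution of the difference system, the NLS resolvent is the Toda resolvent. -/
theorem jetCoeff_eq_toda {sh : ℤ → S → S} {Λ : S ≃+* S} (h₁ : ∀ f, sh 1 f = Λ f)
    (h₂ : ∀ f, sh (-1) f = Λ.symm f) {D : Derivation ℂ S S} (hD : ∀ x, D (Λ x) = Λ (D x))
    {v w : S} (hv : D v = Λ w - w) (hw : D w = w * (v - Λ.symm v)) (k : ℕ) :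
    jetCoeff D v w k
      = (todaA sh v w k, Λ (todaC sh v w k), w * todaC sh v w k) := by
  have flow : ∀ n, D (todaA sh v w n) = w * (Λ (todaC sh v w n) - todaC sh v w n) ∧
      D (Λ (todaC sh v w n)) = Λ (todaA sh v w n) - todaA sh v w n := fun n => by
    have := (isTodaResolvent (v := v) (w := w) h₁ h₂).first_flow_mem (I := ⊥) (by simp) hD
      (by simp [hv]) (by simp [hw]) (n + 1)
    simpa only [coeff_succ_todaAlpha, coeff_succ_todaGamma, Ideal.mem_bot, sub_eq_zero] using this
  induction k using Nat.strong_induction_on with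
  | _ k ih =>
    cases k with
    | zero => rw [jetCoeff_zero, todaA_zero, todaC_zero, map_one, mul_one]
    | succ k =>
      have ihk := ih k (Nat.lt_succ_self k)
      have hc : D (todaC sh v w k) = todaA sh v w k - Λ.symm (todaA sh v w k) := by
        apply Λ.injective
        rw [← hD, (flow k).2, map_sub, RingEquiv.apply_symm_apply]
      refine Prod.ext ?_ ?_
      · rw [jetCoeff_succ_fst, todaA_succ]
        refine (Finset.sum_congr rfl fun ij hij => ?_).trans Finset.Nat.sum_antidiagonal_swap
        have hij := mem_antidiagonal.mp hij
        rw [ih ij.1 (by omega), ih ij.2 (by omega), h₁]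
        simp only [Prod.fst_swap, Prod.snd_swap]
        ring
      · rw [jetCoeff_succ_snd, ihk, todaC_succ, h₂, h₂]
        refine Prod.ext ?_ ?_
        · simp only [(flow k).2, map_add, map_mul, RingEquiv.apply_symm_apply]
          ring
        · simp only [Derivation.leibniz, smul_eq_mul, hc, hw]
          ring

end JetToda

section NLSRecursion

variable {S : Type*} [CommRing S] [Algebra ℂ S] (D : S → S) (q r : S)

theorem nlsCoeff_zero : nlsCoeff D q r 0 = (0, q, -r) := by rw [nlsCoeff]

theorem nlsA_succ (k : ℕ) : nlsA D q r (k + 1) = -((1 / 2 : ℂ) • ∑ ij ∈ antidiagonal k,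
    (nlsA D q r ij.1 * nlsA D q r ij.2 + nlsB D q r ij.1 * nlsC D q r ij.2)) := by
  rw [← sum_fin_eq_sum_antidiagonal fun i j => nlsA D q r i * nlsA D q r j
      + nlsB D q r i * nlsC D q r j]
  conv_lhs => rw [nlsA, nlsCoeff]
  rfl

theorem nlsB_succ (k : ℕ) :
    nlsB D q r (k + 1) = (1 / 2 : ℂ) • D (nlsB D q r k) + q * nlsA D q r k := by
  conv_lhs => rw [nlsB, nlsCoeff]
  rfl

theorem nlsC_succ (k : ℕ) :
    nlsC D q r (k + 1) = -((1 / 2 : ℂ) • D (nlsC D q r k)) - r * nlsA D q r k := by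
  conv_lhs => rw [nlsC, nlsCoeff]
  rfl

end NLSRecursion

section ExpSeries

variable {K : Type*} [CommRing K] [Algebra ℂ K]

theorem epsDeriv_C_mul_T (d : Derivation ℂ (Ser K) (Ser K)) (φ b : Ser K) (n : ℤ) :
    epsDeriv d φ (LaurentPolynomial.C b * LaurentPolynomial.T n)
      = LaurentPolynomial.C (eps * d b + (n : Ser K) * d φ * b) * LaurentPolynomial.T n := by
  rw [epsDeriv, ← LaurentPolynomial.single_eq_C_mul_T, AddMonoidAlgebra.coeff_single,
    Finsupp.sum_single_index]
  simp

theorem C_mul_T_inj {A : Type*} [CommRing A] {a b : Ser A} {n : ℤ}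
    (h : (LaurentPolynomial.C a * LaurentPolynomial.T n : ExpSer A)
      = LaurentPolynomial.C b * LaurentPolynomial.T n) : a = b := by
  have := congrArg (fun f : ExpSer A => f.coeff n) h
  simpa [← LaurentPolynomial.single_eq_C_mul_T] using this

/-- The constant `1 / 2` of `Ser K`. -/
def half (K : Type*) [CommRing K] [Algebra ℂ K] : Ser K := algebraMap ℂ (Ser K) (1 / 2)

theorem two_mul_half : 2 * half K = 1 := by
  have : algebraMap ℂ (Ser K) (2 * (1 / 2)) = 1 := by norm_num
  rw [← this, map_mul, half]
  congr 1
  exact (map_ofNat _ 2).symm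

theorem half_smul (f : ExpSer K) : (1 / 2 : ℂ) • f = LaurentPolynomial.C (half K) * f := by
  rw [Algebra.smul_def]
  rfl

theorem derivation_half_pow_mul (d : Derivation ℂ (Ser K) (Ser K)) (k : ℕ) (f : Ser K) :
    d (half K ^ k * f) = half K ^ k * d f := by
  rw [half, ← map_pow, ← Algebra.smul_def, ← Algebra.smul_def, d.map_smul]

variable (d : Derivation ℂ (Ser K) (Ser K)) (φ W : Ser K)

theorem nls_eq_jetCoeff (k : ℕ) :
    nlsA (epsDeriv d φ) (qOf K) (rOf W) k
      = LaurentPolynomial.C (half K ^ k * (jetCoeff (fun f => eps * d f) (d φ) W k).1) ∧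
    nlsB (epsDeriv d φ) (qOf K) (rOf W) k
      = LaurentPolynomial.C (half K ^ k * (jetCoeff (fun f => eps * d f) (d φ) W k).2.1)
        * LaurentPolynomial.T 1 ∧
    nlsC (epsDeriv d φ) (qOf K) (rOf W) k
      = LaurentPolynomial.C (-(half K ^ k * (jetCoeff (fun f => eps * d f) (d φ) W k).2.2))
        * LaurentPolynomial.T (-1) := by
  have hT : (LaurentPolynomial.T 1 * LaurentPolynomial.T (-1) : ExpSer K) = 1 := by
    rw [← LaurentPolynomial.T_add]
    exact LaurentPolynomial.T_zero
  have h2 : (2 * LaurentPolynomial.C (half K) : ExpSer K) = 1 := by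
    have := congrArg (LaurentPolynomial.C (R := Ser K)) (two_mul_half (K := K))
    rwa [map_mul, map_one, map_ofNat] at this
  induction k using Nat.strong_induction_on with
  | _ k ih =>
    cases k with
    | zero =>
      simp only [nlsA, nlsB, nlsC, nlsCoeff_zero, jetCoeff_zero, qOf, rOf, pow_zero, one_mul,
        map_zero, map_one, map_neg, true_and]
      ring
    | succ k =>
      obtain ⟨hA, hB, hC⟩ := ih k (Nat.lt_succ_self k)
      refine ⟨?_, ?_, ?_⟩
      · rw [nlsA_succ, jetCoeff_succ_fst, half_smul, Finset.mul_sum, Finset.mul_sum, map_sum,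
          ← Finset.sum_neg_distrib]
        refine Finset.sum_congr rfl fun ij hij => ?_
        have hij := mem_antidiagonal.mp hij
        obtain ⟨hA₁, hB₁, -⟩ := ih ij.1 (by omega)
        obtain ⟨hA₂, -, hC₂⟩ := ih ij.2 (by omega)
        rw [hA₁, hA₂, hB₁, hC₂, ← hij]
        simp only [map_mul, map_neg, map_sub, map_pow, pow_succ, pow_add]
        linear_combination LaurentPolynomial.C (half K) * LaurentPolynomial.C (half K) ^ ij.1
          * LaurentPolynomial.C (half K) ^ ij.2
          * LaurentPolynomial.C (jetCoeff (fun f => eps * d f) (d φ) W ij.1).2.1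
          * LaurentPolynomial.C (jetCoeff (fun f => eps * d f) (d φ) W ij.2).2.2 * hT
      · rw [nlsB_succ, hA, hB, jetCoeff_succ_snd, half_smul, epsDeriv_C_mul_T,
          derivation_half_pow_mul, qOf]
        simp only [map_mul, map_add, map_pow, pow_succ, Int.cast_one, map_one, map_ofNat]
        linear_combination -LaurentPolynomial.T 1 * LaurentPolynomial.C (half K) ^ k
          * LaurentPolynomial.C (jetCoeff (fun f => eps * d f) (d φ) W k).1 * h2
      · rw [nlsC_succ, hA, hC, jetCoeff_succ_snd, half_smul, epsDeriv_C_mul_T, map_neg,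
          derivation_half_pow_mul, rOf]
        simp only [map_mul, map_add, map_sub, map_pow, pow_succ, Int.cast_one, Int.cast_neg,
          map_one, map_ofNat, map_neg]
        linear_combination LaurentPolynomial.T (-1) * LaurentPolynomial.C (half K) ^ k
          * LaurentPolynomial.C W
          * LaurentPolynomial.C (jetCoeff (fun f => eps * d f) (d φ) W k).1 * h2

/-- The NLS hierarchy in terms of `V = ∂_X φ` and `W`. -/
theorem IsNLSSolution.jet {dX : Derivation ℂ K K} {φ W : Ser K} (h : IsNLSSolution dX φ W) (j : ℕ) :
    dt dX j φ = (jetCoeff (fun f => eps * dt dX 0 f) (dt dX 0 φ) W (j + 1)).2.1 ∧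
    eps * dt dX j W = W * (jetCoeff (fun f => eps * dt dX 0 f) (dt dX 0 φ) W (j + 1)).2.1
      - (jetCoeff (fun f => eps * dt dX 0 f) (dt dX 0 φ) W (j + 1)).2.2 := by
  have h2 : ∀ k, (2 : Ser K) ^ k * half K ^ k = 1 := fun k => by
    rw [← mul_pow, two_mul_half, one_pow]
  obtain ⟨hq, hr⟩ := h j
  obtain ⟨-, hB, hC⟩ := nls_eq_jetCoeff (dt dX 0) φ W (j + 1)
  have hq' : qOf K = LaurentPolynomial.C 1 * LaurentPolynomial.T 1 := by
    rw [qOf, map_one, one_mul]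
  have h2' : (2 : ExpSer K) ^ (j + 1) = LaurentPolynomial.C (2 ^ (j + 1)) := by
    rw [map_pow, map_ofNat]
  rw [hB, hq', epsDeriv_C_mul_T, h2', ← mul_assoc, ← map_mul] at hq
  rw [hC, rOf, epsDeriv_C_mul_T, h2', ← mul_assoc, ← map_mul] at hr
  have hq := C_mul_T_inj hq
  have hr := C_mul_T_inj hr
  rw [← mul_assoc, h2, Derivation.map_one_eq_zero] at hq
  rw [mul_neg, ← mul_assoc, h2] at hr
  have hq : dt dX j φ = (jetCoeff (fun f => eps * dt dX 0 f) (dt dX 0 φ) W (j + 1)).2.1 := by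
    simpa using hq
  refine ⟨hq, ?_⟩
  rw [← hq]
  push_cast at hr
  linear_combination hr

/-- The NLS tau-structure coincides with the Toda tau-structure. -/
theorem nlsOmega_eq_todaOmega {sh : ℤ → Ser K → Ser K} {v w φ : Ser K}
    (hφ : d φ = v)
    (h : ∀ k, jetCoeff (fun f => eps * d f) v w k
      = (todaA sh v w k, sh 1 (todaC sh v w k), w * todaC sh v w k)) (i j : ℕ) :
    nlsOmega (epsDeriv d φ) (qOf K) (rOf w) i j = LaurentPolynomial.C (todaOmega sh v w i j) := by
  have hT : (LaurentPolynomial.T 1 * LaurentPolynomial.T (-1) : ExpSer K) = 1 := by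
    rw [← LaurentPolynomial.T_add]
    exact LaurentPolynomial.T_zero
  have h2 : (2 * LaurentPolynomial.C (half K) : ExpSer K) = 1 := by
    have := congrArg (LaurentPolynomial.C (R := Ser K)) (two_mul_half (K := K))
    rwa [map_mul, map_one, map_ofNat] at this
  have htr : ∀ m n, (nlsRes (epsDeriv d φ) (qOf K) (rOf w) m
      * nlsRes (epsDeriv d φ) (qOf K) (rOf w) n).trace
      = 4 * LaurentPolynomial.C (half K) ^ (m + n)
        * LaurentPolynomial.C (todaRes sh v w m * todaRes sh v w n).trace := by
    intro m n
    have hA := fun k => (nls_eq_jetCoeff d φ w k).1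
    have hB := fun k => (nls_eq_jetCoeff d φ w k).2.1
    have hC := fun k => (nls_eq_jetCoeff d φ w k).2.2
    simp only [hφ, h] at hA hB hC
    cases m with
    | zero =>
      cases n with
      | zero => simp [nlsRes, todaRes, Matrix.trace_fin_two]; norm_num
      | succ n =>
        simp [nlsRes, todaRes, Matrix.trace_fin_two, hA, pow_succ]
        linear_combination (-2) * LaurentPolynomial.C (half K) ^ n
          * LaurentPolynomial.C (todaA sh v w n) * h2
    | succ m =>
      cases n with
      | zero =>
        simp [nlsRes, todaRes, Matrix.trace_fin_two, hA, pow_succ]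
        linear_combination (-2) * LaurentPolynomial.C (half K) ^ m
          * LaurentPolynomial.C (todaA sh v w m) * h2
      | succ n =>
        simp only [nlsRes, todaRes, Matrix.trace_fin_two, hA, hB, hC, Matrix.mul_apply,
          Fin.sum_univ_two, Matrix.of_apply, Matrix.cons_val', Matrix.cons_val_zero,
          Matrix.cons_val_one, map_add, map_mul, map_neg, map_pow, pow_succ, pow_add, todaB]
        linear_combination
          -(LaurentPolynomial.C (half K) ^ m * LaurentPolynomial.C (half K) ^ n
            * LaurentPolynomial.C w
            * (LaurentPolynomial.C (sh 1 (todaC sh v w m)) * LaurentPolynomial.C (todaC sh v w n)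
              + LaurentPolynomial.C (sh 1 (todaC sh v w n)) * LaurentPolynomial.C (todaC sh v w m)))
            * hT
          - LaurentPolynomial.C (half K) ^ m * LaurentPolynomial.C (half K) ^ n
            * (2 * LaurentPolynomial.C (todaA sh v w m) * LaurentPolynomial.C (todaA sh v w n)
              - LaurentPolynomial.C w
                * (LaurentPolynomial.C (sh 1 (todaC sh v w m)) * LaurentPolynomial.C (todaC sh v w n)
                + LaurentPolynomial.C (sh 1 (todaC sh v w n))
                  * LaurentPolynomial.C (todaC sh v w m)))
            * (2 * LaurentPolynomial.C (half K) + 1) * h2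
  rw [nlsOmega, todaOmega, map_sum, Finset.mul_sum]
  refine Finset.sum_congr rfl fun k hk => ?_
  have hk := Finset.mem_range.mp hk
  rw [htr, show i - k + (j + 2 + k) = i + j + 2 by omega]
  have h3 : (2 : ExpSer K) ^ (i + j) * LaurentPolynomial.C (half K) ^ (i + j) = 1 := by
    rw [← mul_pow, h2, one_pow]
  simp only [map_mul, map_add, map_natCast, map_one]
  rw [pow_add _ (i + j) 2]
  linear_combination ((k : ExpSer K) + 1)
    * LaurentPolynomial.C (todaRes sh v w (i - k) * todaRes sh v w (j + 2 + k)).trace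
    * (4 * LaurentPolynomial.C (half K) ^ 2 * h3 + (2 * LaurentPolynomial.C (half K) + 1) * h2)

end ExpSeries

section Nabla

variable {R : Type*} [CommRing R] [Algebra ℂ R]

/-- The generating series `∑ₗ u^{l+2} Dₗ f` of a family of derivations. -/
def nabla (D : ℕ → Derivation ℂ R R) (f : R) : PowerSeries R :=
  PowerSeries.X ^ 2 * PowerSeries.mk fun l => D l f

theorem coeff_nabla (D : ℕ → Derivation ℂ R R) (f : R) (l : ℕ) :
    PowerSeries.coeff (l + 2) (nabla D f) = D l f := by
  rw [nabla, add_comm, PowerSeries.coeff_X_pow_mul', if_pos (Nat.le_add_right 2 l),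
    Nat.add_sub_cancel_left, PowerSeries.coeff_mk]

theorem nabla_add (D : ℕ → Derivation ℂ R R) (f g : R) :
    nabla D (f + g) = nabla D f + nabla D g := by
  rw [nabla, nabla, nabla, ← mul_add]
  congr 1
  ext l
  simp

theorem nabla_sub (D : ℕ → Derivation ℂ R R) (f g : R) :
    nabla D (f - g) = nabla D f - nabla D g := by
  rw [eq_sub_iff_add_eq, ← nabla_add, sub_add_cancel]

theorem nabla_mul (D : ℕ → Derivation ℂ R R) (f g : R) :
    nabla D (f * g) = PowerSeries.C f * nabla D g + PowerSeries.C g * nabla D f := by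
  rw [nabla, nabla, nabla, mul_left_comm, mul_left_comm (PowerSeries.C g), ← mul_add]
  congr 1
  ext l
  simp

theorem nabla_eq_zero {D : ℕ → Derivation ℂ R R} {f : R} (h : ∀ l, D l f = 0) :
    nabla D f = 0 := by
  rw [nabla]
  convert mul_zero _
  ext l
  simp [h]

theorem nabla_one (D : ℕ → Derivation ℂ R R) : nabla D 1 = 0 :=
  nabla_eq_zero fun l => (D l).map_one_eq_zero

theorem nabla_map {R' : Type*} [CommRing R'] [Algebra ℂ R'] (F : R →+* R')
    {D : ℕ → Derivation ℂ R R} {D' : ℕ → Derivation ℂ R' R'}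
    (h : ∀ l x, D' l (F x) = F (D l x)) (f : R) :
    nabla D' (F f) = PowerSeries.map F (nabla D f) := by
  rw [nabla, nabla, map_mul, map_pow, PowerSeries.map_X]
  congr 1
  ext l
  simp [h]

theorem map_map_eq_C_comp {S S' : Type*} [CommRing S] [CommRing S'] (F : S →+* S')
    (f : PowerSeries S) :
    PowerSeries.map (PowerSeries.map F) (PowerSeries.map PowerSeries.C f)
      = PowerSeries.map PowerSeries.C (PowerSeries.map F f) := by
  ext n : 1
  simp

end Nabla

section Flow

/-- The coefficientwise extension of a derivation to power series in one variable. -/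
def seriesDeriv {R : Type*} [CommRing R] [Algebra ℂ R] (d : Derivation ℂ R R) :
    Derivation ℂ (PowerSeries R) (PowerSeries R) :=
  mapDeriv (σ := Unit) d

theorem coeff_seriesDeriv {R : Type*} [CommRing R] [Algebra ℂ R] (d : Derivation ℂ R R)
    (f : PowerSeries R) (n : ℕ) :
    PowerSeries.coeff n (seriesDeriv d f) = d (PowerSeries.coeff n f) := rfl

theorem seriesDeriv_C {R : Type*} [CommRing R] [Algebra ℂ R] (d : Derivation ℂ R R) (x : R) :
    seriesDeriv d (PowerSeries.C x) = PowerSeries.C (d x) := by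
  ext n
  rw [coeff_seriesDeriv, PowerSeries.coeff_C, PowerSeries.coeff_C]
  split_ifs <;> simp

theorem seriesDeriv_X {R : Type*} [CommRing R] [Algebra ℂ R] (d : Derivation ℂ R R) :
    seriesDeriv d PowerSeries.X = 0 := by
  ext n
  rw [coeff_seriesDeriv, PowerSeries.coeff_X]
  split_ifs <;> simp

theorem flow_linear {B : Type*} [CommRing B] {z u v w w' a a' b b' g g' g'' h h' h'' da da' dg' : B}
    (hl : (1 - z * v) * dg' - z * (b' - b) * g' = z * (da + da'))
    (hz : (1 - z * v) * g' = z * (1 + a + a')) (hu : (1 - u * v) * h' = u * (1 + b + b'))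
    (fz : (1 - z * v) * (a' - a) = z * (w' * g'' - w * g))
    (fu : (1 - u * v) * (b' - b) = u * (w' * h'' - w * h)) :
    (1 - z * v) * ((z - u) * (dg' - h' * g') - u * z * (h' * (1 + 2 * a') - g' * (1 + 2 * b')))
      = z * (((z - u) * da - u * z * w * (h * g' - g * h'))
        + ((z - u) * da' - u * z * w' * (h' * g'' - g' * h''))) := by
  linear_combination (z - u) * hl - u * z * h' * fz + z ^ 2 * g' * fu
    - (1 - z * v) * z * g' * hu + (1 - z * v) * u * h' * hz

theorem flow_quadratic {B : Type*} [CommRing B] {z u v w a a' b b' g g' h h' da dg dg' : B}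
    (hq : (1 + 2 * a) * da = w * (h' - h) * g * g' + w * dg * g' + w * g * dg')
    (hz : (1 - z * v) * g' = z * (1 + a + a')) (hu : (1 - u * v) * h' = u * (1 + b + b')) :
    (1 + 2 * a) * ((z - u) * da - u * z * w * (h * g' - g * h'))
      = w * (((z - u) * (dg - h * g) - u * z * (h * (1 + 2 * a) - g * (1 + 2 * b))) * g'
        + g * ((z - u) * (dg' - h' * g')
          - u * z * (h' * (1 + 2 * a') - g' * (1 + 2 * b')))) := by
  linear_combination (z - u) * hq - 2 * u * w * g * h' * hz + 2 * z * w * g * g' * hu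

variable {S : Type*} [CommRing S] [Algebra ℂ S]

/-- The evolution `∇(u) v = (Λ - 1) α(u)`, `∇(u) w = w (Λ - 1) γ(u)` of the Toda lattice hierarchy
as an identity of generating series, with `∇(u) = ∑ₗ u^{l+2} Dₗ`. -/
structure IsTodaFlow (Λ : S ≃+* S) (v w : S) (α γ : PowerSeries S) (D : ℕ → Derivation ℂ S S) :
    Prop where
  comm : ∀ l x, D l (Λ x) = Λ (D l x)
  fst : nabla D v = seriesShift Λ α - α
  snd : nabla D w = PowerSeries.C w * (seriesShift Λ γ - γ)

variable {Λ : S ≃+* S} {v w : S} {α γ : PowerSeries S} {D : ℕ → Derivation ℂ S S}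

theorem nabla_C (D : ℕ → Derivation ℂ S S) (x : S) :
    nabla (fun l => seriesDeriv (D l)) (PowerSeries.C x)
      = PowerSeries.map (PowerSeries.C (R := S)) (nabla D x) := by
  have h : ∀ (l : ℕ) (x : S), seriesDeriv (D l) (PowerSeries.C x) = PowerSeries.C (D l x) :=
    fun l x => seriesDeriv_C (D l) x
  exact nabla_map (PowerSeries.C (R := S)) h x

theorem nabla_X (D : ℕ → Derivation ℂ S S) :
    nabla (fun l => seriesDeriv (D l)) (PowerSeries.X : PowerSeries S) = 0 :=
  nabla_eq_zero fun l => seriesDeriv_X (D l)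

namespace IsTodaFlow

variable (hD : IsTodaFlow Λ v w α γ D)
include hD

theorem nabla_seriesShift (f : PowerSeries S) :
    nabla (fun l => seriesDeriv (D l)) (seriesShift Λ f)
      = PowerSeries.map (seriesShift Λ) (nabla (fun l => seriesDeriv (D l)) f) :=
  nabla_map (seriesShift Λ) (fun l f => by ext n; simp [coeff_seriesDeriv, hD.comm]) f

theorem nabla_linear (h : IsTodaResolvent Λ v w α γ) :
    (1 - PowerSeries.C PowerSeries.X * PowerSeries.C (PowerSeries.C v))
        * nabla (fun l => seriesDeriv (D l)) (seriesShift Λ γ)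
      - PowerSeries.C PowerSeries.X * (PowerSeries.map PowerSeries.C (seriesShift Λ α)
        - PowerSeries.map PowerSeries.C α) * PowerSeries.C (seriesShift Λ γ)
      = PowerSeries.C PowerSeries.X * (nabla (fun l => seriesDeriv (D l)) α
        + nabla (fun l => seriesDeriv (D l)) (seriesShift Λ α)) := by
  have hl := congrArg (nabla (fun l => seriesDeriv (D l))) h.linear
  rw [nabla_mul, nabla_mul, nabla_sub, nabla_mul, nabla_add, nabla_add, nabla_one, nabla_X,
    nabla_C, hD.fst, map_sub, map_sub, map_one, map_mul] at hl
  linear_combination hl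

theorem nabla_quadratic (h : IsTodaResolvent Λ v w α γ) :
    (1 + 2 * PowerSeries.C α) * nabla (fun l => seriesDeriv (D l)) α
      = PowerSeries.C (PowerSeries.C w) * (PowerSeries.map PowerSeries.C (seriesShift Λ γ)
          - PowerSeries.map PowerSeries.C γ) * PowerSeries.C γ * PowerSeries.C (seriesShift Λ γ)
        + PowerSeries.C (PowerSeries.C w) * nabla (fun l => seriesDeriv (D l)) γ
          * PowerSeries.C (seriesShift Λ γ)
        + PowerSeries.C (PowerSeries.C w) * PowerSeries.C γ
          * nabla (fun l => seriesDeriv (D l)) (seriesShift Λ γ) := by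
  have hq := congrArg (nabla (fun l => seriesDeriv (D l))) h.quadratic
  rw [pow_two, nabla_add, nabla_mul, nabla_mul, nabla_mul, nabla_C, hD.snd, map_mul, map_mul,
    map_sub, PowerSeries.map_C] at hq
  linear_combination hq

/-- The equations `ε ∇(μ) R(λ) = [R(μ), R(λ)] / (μ - λ) + [Q(μ), R(λ)]` for the entries of the
matrix resolvent, with `z = λ⁻¹` and `u = μ⁻¹`. -/
theorem nabla_resolvent (h : IsTodaResolvent Λ v w α γ) :
    (PowerSeries.C PowerSeries.X - PowerSeries.X)
        * nabla (fun l => seriesDeriv (D l)) α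
      = PowerSeries.X * PowerSeries.C PowerSeries.X * PowerSeries.C (PowerSeries.C w)
        * (PowerSeries.map PowerSeries.C γ * PowerSeries.C (seriesShift Λ γ)
          - PowerSeries.C γ * PowerSeries.map PowerSeries.C (seriesShift Λ γ)) ∧
    (PowerSeries.C PowerSeries.X - PowerSeries.X)
        * (nabla (fun l => seriesDeriv (D l)) γ
          - PowerSeries.map PowerSeries.C γ * PowerSeries.C γ)
      = PowerSeries.X * PowerSeries.C PowerSeries.X
        * (PowerSeries.map PowerSeries.C γ * (1 + 2 * PowerSeries.C α)
          - PowerSeries.C γ * (1 + 2 * PowerSeries.map PowerSeries.C α)) := by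
  have hl := hD.nabla_linear h
  have hq := hD.nabla_quadratic h
  have hlz := congrArg (PowerSeries.C (R := PowerSeries S)) h.linear
  have hfz := congrArg (PowerSeries.C (R := PowerSeries S)) h.linear_fst
  have hlu := congrArg (PowerSeries.map (PowerSeries.C (R := S))) h.linear
  have hfu := congrArg (PowerSeries.map (PowerSeries.C (R := S))) h.linear_fst
  simp only [map_mul, map_sub, map_add, map_one, PowerSeries.map_X, PowerSeries.map_C]
    at hlz hfz hlu hfu
  have e₁ := flow_linear hl hlz hlu hfz hfu
  have e₂ := flow_quadratic hq hlz hlu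
  have s₁ : PowerSeries.map (seriesShift Λ) ((PowerSeries.C PowerSeries.X - PowerSeries.X)
        * nabla (fun l => seriesDeriv (D l)) α
      - PowerSeries.X * PowerSeries.C PowerSeries.X * PowerSeries.C (PowerSeries.C w)
        * (PowerSeries.map PowerSeries.C γ * PowerSeries.C (seriesShift Λ γ)
          - PowerSeries.C γ * PowerSeries.map PowerSeries.C (seriesShift Λ γ)))
      = (PowerSeries.C PowerSeries.X - PowerSeries.X)
        * nabla (fun l => seriesDeriv (D l)) (seriesShift Λ α)
      - PowerSeries.X * PowerSeries.C PowerSeries.X * PowerSeries.C (PowerSeries.C (Λ w))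
        * (PowerSeries.map PowerSeries.C (seriesShift Λ γ)
            * PowerSeries.C (seriesShift Λ (seriesShift Λ γ))
          - PowerSeries.C (seriesShift Λ γ)
            * PowerSeries.map PowerSeries.C (seriesShift Λ (seriesShift Λ γ))) := by
    simp only [map_sub, map_mul, hD.nabla_seriesShift, PowerSeries.map_X,
      PowerSeries.map_C, map_map_eq_C_comp, RingHom.coe_coe]
  have s₃ : PowerSeries.map (seriesShift Λ) ((PowerSeries.C PowerSeries.X - PowerSeries.X)
        * (nabla (fun l => seriesDeriv (D l)) γ
          - PowerSeries.map PowerSeries.C γ * PowerSeries.C γ)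
      - PowerSeries.X * PowerSeries.C PowerSeries.X
        * (PowerSeries.map PowerSeries.C γ * (1 + 2 * PowerSeries.C α)
          - PowerSeries.C γ * (1 + 2 * PowerSeries.map PowerSeries.C α)))
      = (PowerSeries.C PowerSeries.X - PowerSeries.X)
        * (nabla (fun l => seriesDeriv (D l)) (seriesShift Λ γ)
          - PowerSeries.map PowerSeries.C (seriesShift Λ γ) * PowerSeries.C (seriesShift Λ γ))
      - PowerSeries.X * PowerSeries.C PowerSeries.X
        * (PowerSeries.map PowerSeries.C (seriesShift Λ γ)
            * (1 + 2 * PowerSeries.C (seriesShift Λ α))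
          - PowerSeries.C (seriesShift Λ γ)
            * (1 + 2 * PowerSeries.map PowerSeries.C (seriesShift Λ α))) := by
    simp only [map_sub, map_mul, map_add, map_one, map_ofNat, hD.nabla_seriesShift,
      PowerSeries.map_X, PowerSeries.map_C, map_map_eq_C_comp]
  rw [← s₁, ← s₃] at e₁
  rw [← s₃] at e₂
  rw [← sub_eq_zero, ← sub_eq_zero (a := (PowerSeries.C PowerSeries.X - PowerSeries.X)
    * (nabla (fun l => seriesDeriv (D l)) γ - _))]
  generalize (PowerSeries.C PowerSeries.X - PowerSeries.X)
        * nabla (fun l => seriesDeriv (D l)) α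
      - PowerSeries.X * PowerSeries.C PowerSeries.X * PowerSeries.C (PowerSeries.C w)
        * (PowerSeries.map PowerSeries.C γ * PowerSeries.C (seriesShift Λ γ)
          - PowerSeries.C γ * PowerSeries.map PowerSeries.C (seriesShift Λ γ)) = N₁ at e₁ e₂ ⊢
  generalize (PowerSeries.C PowerSeries.X - PowerSeries.X)
        * (nabla (fun l => seriesDeriv (D l)) γ
          - PowerSeries.map PowerSeries.C γ * PowerSeries.C γ)
      - PowerSeries.X * PowerSeries.C PowerSeries.X
        * (PowerSeries.map PowerSeries.C γ * (1 + 2 * PowerSeries.C α)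
          - PowerSeries.C γ * (1 + 2 * PowerSeries.map PowerSeries.C α)) = N₃ at e₁ e₂ ⊢
  have c₁ : ∀ l, (1 - PowerSeries.X * PowerSeries.C v) * seriesShift Λ (PowerSeries.coeff l N₃)
      - PowerSeries.X * (PowerSeries.coeff l N₁ + seriesShift Λ (PowerSeries.coeff l N₁)) = 0 := by
    intro l
    have := congrArg (PowerSeries.coeff l) e₁
    rw [← map_mul, ← map_one PowerSeries.C, ← map_sub] at this
    simp only [PowerSeries.coeff_C_mul, map_add, PowerSeries.coeff_map] at this
    exact sub_eq_zero.mpr this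
  have c₂ : ∀ l, (1 + 2 * α) * PowerSeries.coeff l N₁ - PowerSeries.C w
      * (PowerSeries.coeff l N₃ * seriesShift Λ γ
        + γ * seriesShift Λ (PowerSeries.coeff l N₃)) = 0 := by
    intro l
    have := congrArg (PowerSeries.coeff l) e₂
    have h2 : (1 + 2 * PowerSeries.C α : PowerSeries (PowerSeries S))
        = PowerSeries.C (1 + 2 * α) := by
      rw [map_add, map_mul, map_one, map_ofNat]
    rw [h2, PowerSeries.coeff_C_mul] at this
    simp only [PowerSeries.coeff_C_mul, PowerSeries.coeff_mul_C, map_add,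
      PowerSeries.coeff_map] at this
    exact sub_eq_zero.mpr this
  have key := fun l => h.mem_of_linearized (I := ⊥) (by simp)
    (fun n => by rw [c₁ l, map_zero]; exact Ideal.zero_mem _)
    (fun n => by rw [c₂ l, map_zero]; exact Ideal.zero_mem _)
  constructor
  · ext l n
    exact (key l n).1
  · ext l n
    exact (key l n).2

end IsTodaFlow

end Flow

section Identities

theorem flow_linear' {B : Type*} [CommRing B] {z u v a a' b b' g' h' dg' : B}
    (hg : (z - u) * (dg' - h' * g') = u * z * (h' * (1 + 2 * a') - g' * (1 + 2 * b')))
    (hz : (1 - z * v) * g' = z * (1 + a + a')) (hu : (1 - u * v) * h' = u * (1 + b + b')) :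
    (z - u) * (dg' + h' * g') = u * z * (g' * (1 + 2 * b) - h' * (1 + 2 * a)) := by
  linear_combination hg - 2 * u * h' * hz + 2 * z * g' * hu

theorem tau_structure_shift {B : Type*} [CommRing B] {z u v w w' a a' b b' g g' g'' h h' h'' dg' : B}
    (hg : (z - u) * (dg' - h' * g') = u * z * (h' * (1 + 2 * a') - g' * (1 + 2 * b')))
    (hz : (1 - z * v) * g' = z * (1 + a + a')) (hu : (1 - u * v) * h' = u * (1 + b + b'))
    (fz : (1 - z * v) * (a' - a) = z * (w' * g'' - w * g))
    (fu : (1 - u * v) * (b' - b) = u * (w' * h'' - w * h)) :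
    (z - u) ^ 2 * dg' = u ^ 2 * z ^ 2 * ((a' + b' + 2 * a' * b' - w' * (g'' * h' + g' * h''))
      - (a + b + 2 * a * b - w * (g' * h + g * h'))) := by
  linear_combination (z - u) * hg - u ^ 2 * z * h' * fz - u * z ^ 2 * g' * fu
    - (z - u) * u * h' * hz + (z - u) * z * g' * hu + u * z ^ 2 * (a' - a) * hu
    + u ^ 2 * z * (b' - b) * hz

theorem tau_structure_flow {B : Type*} [CommRing B]
    {y z u w az ay au gz gy gu gz' gy' gu' daz day dgz dgy dgz' dgy' dw dF : B}
    (haz : (z - u) * daz = u * z * w * (gu * gz' - gz * gu'))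
    (hay : (y - u) * day = u * y * w * (gu * gy' - gy * gu'))
    (hgz : (z - u) * (dgz - gu * gz) = u * z * (gu * (1 + 2 * az) - gz * (1 + 2 * au)))
    (hgy : (y - u) * (dgy - gu * gy) = u * y * (gu * (1 + 2 * ay) - gy * (1 + 2 * au)))
    (hgz' : (z - u) * (dgz' + gu' * gz') = u * z * (gz' * (1 + 2 * au) - gu' * (1 + 2 * az)))
    (hgy' : (y - u) * (dgy' + gu' * gy') = u * y * (gy' * (1 + 2 * au) - gu' * (1 + 2 * ay)))
    (hw : dw = w * (gu' - gu))
    (hF : dF = daz * (1 + 2 * ay) + day * (1 + 2 * az) - dw * (gz' * gy + gz * gy')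
      - w * (dgz' * gy + gz' * dgy + dgz * gy' + gz * dgy')) :
    (z - u) * (y - u) * dF = u ^ 2 * (y - z) * (w *
      (gu * gz' * (1 + 2 * ay) - gz * gu' * (1 + 2 * ay) - gz' * gy * (1 + 2 * au)
        + gu' * gy * (1 + 2 * az) - gu * gy' * (1 + 2 * az) + gz * gy' * (1 + 2 * au))) := by
  subst hw
  linear_combination (z - u) * (y - u) * hF + (y - u) * (1 + 2 * ay) * haz
    + (z - u) * (1 + 2 * az) * hay - (y - u) * w * gy * hgz' - (y - u) * w * gy' * hgz
    - (z - u) * w * gz' * hgy - (z - u) * w * gz * hgy'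

theorem cancel_sub_mul_sq {B : Type*} [CommRing B] {y z u m t : B} (hyz : IsLeftRegular (y - z))
    (hu : IsLeftRegular u)
    (h : (z - u) * (y - u) * ((y - z) ^ 2 * (u ^ 2 * m)) = u ^ 2 * (y - z) * t) :
    (y - z) * ((z - u) * ((y - u) * m)) = t := by
  apply hyz.mul (hu.pow 2)
  simp only
  linear_combination h

end Identities

section Regular

variable {R : Type*} [CommRing R]

theorem isLeftRegular_C_sub_X {p : R} (hp : IsLeftRegular p) :
    IsLeftRegular (PowerSeries.C p - PowerSeries.X : PowerSeries R) := by
  rw [isLeftRegular_iff_right_eq_zero_of_mul]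
  intro f hf
  have h0 : ∀ x, p * x = 0 → x = 0 := isLeftRegular_iff_right_eq_zero_of_mul.mp hp
  ext n
  induction n with
  | zero =>
    have := congrArg (PowerSeries.coeff 0) hf
    rw [sub_mul, map_sub, PowerSeries.coeff_C_mul, PowerSeries.coeff_zero_X_mul, sub_zero] at this
    exact h0 _ this
  | succ n ih =>
    have := congrArg (PowerSeries.coeff (n + 1)) hf
    rw [sub_mul, map_sub, PowerSeries.coeff_C_mul, PowerSeries.coeff_succ_X_mul, ih, map_zero,
      sub_zero] at this
    exact h0 _ this

theorem isLeftRegular_series_X : IsLeftRegular (PowerSeries.X : PowerSeries R) :=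
  fun _ _ h => PowerSeries.X_mul_cancel h

theorem isLeftRegular_series_C {p : R} (hp : IsLeftRegular p) :
    IsLeftRegular (PowerSeries.C p : PowerSeries R) := by
  intro f g h
  ext n
  have := congrArg (PowerSeries.coeff n) h
  simp only [PowerSeries.coeff_C_mul] at this
  exact hp this

/-- The exchange of the two variables of `R⟦z⟧⟦u⟧`. -/
def swapVars : PowerSeries (PowerSeries R) →+* PowerSeries (PowerSeries R) where
  toFun f := PowerSeries.mk fun m => PowerSeries.mk fun n =>
    PowerSeries.coeff m (PowerSeries.coeff n f)
  map_zero' := by ext; simp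
  map_one' := by
    ext m n
    simp only [PowerSeries.coeff_mk, PowerSeries.coeff_one]
    split_ifs <;> simp_all [PowerSeries.coeff_one]
  map_add' f g := by ext; simp
  map_mul' f g := by
    ext m n
    simp only [PowerSeries.coeff_mk, PowerSeries.coeff_mul, map_sum]
    exact Finset.sum_comm

theorem coeff_swapVars (f : PowerSeries (PowerSeries R)) (m n : ℕ) :
    PowerSeries.coeff n (PowerSeries.coeff m (swapVars f))
      = PowerSeries.coeff m (PowerSeries.coeff n f) := by
  simp [swapVars]

theorem swapVars_C (f : PowerSeries R) :
    swapVars (PowerSeries.C f) = PowerSeries.map PowerSeries.C f := by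
  ext m n
  rw [coeff_swapVars, PowerSeries.coeff_map, PowerSeries.coeff_C, PowerSeries.coeff_C]
  split_ifs <;> simp

theorem swapVars_map_C (f : PowerSeries R) :
    swapVars (PowerSeries.map PowerSeries.C f) = PowerSeries.C f := by
  ext m n
  rw [coeff_swapVars, PowerSeries.coeff_map, PowerSeries.coeff_C, PowerSeries.coeff_C]
  split_ifs <;> simp

theorem swapVars_X : swapVars (PowerSeries.X : PowerSeries (PowerSeries R))
    = PowerSeries.C PowerSeries.X := by
  rw [← swapVars_map_C, PowerSeries.map_X]

end Regular

section DoubleQuotient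

variable {S : Type*} [CommRing S]

/-- Division of a doubly vanishing series by `(z - u)²`: the coefficients of the quotient, with the
second index shifted by two. -/
def quotCoeff (f : ℕ → ℕ → S) (i j : ℕ) : S :=
  ∑ k ∈ Finset.range (i + 1), ((k : S) + 1) * f (i - k) (j + k)

/-- The partial sums along antidiagonals. -/
def antidiagSum (f : ℕ → ℕ → S) (i j : ℕ) : S :=
  ∑ k ∈ Finset.range (i + 1), f (i - k) (j + k)

theorem antidiagSum_succ (f : ℕ → ℕ → S) (i j : ℕ) :
    antidiagSum f (i + 1) j = f (i + 1) j + antidiagSum f i (j + 1) := by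
  rw [antidiagSum, Finset.sum_range_succ', add_comm, antidiagSum]
  simp [add_comm, add_left_comm]

theorem quotCoeff_succ (f : ℕ → ℕ → S) (i j : ℕ) :
    quotCoeff f (i + 1) j = f (i + 1) j + quotCoeff f i (j + 1) + antidiagSum f i (j + 1) := by
  rw [quotCoeff, Finset.sum_range_succ', add_comm, quotCoeff, antidiagSum, add_assoc,
    ← Finset.sum_add_distrib]
  congr 1
  · simp
  · refine Finset.sum_congr rfl fun k _ => ?_
    rw [Nat.add_sub_add_right, show j + (k + 1) = j + 1 + k by omega]
    push_cast
    ring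

theorem quotCoeff_zero_left (f : ℕ → ℕ → S) (j : ℕ) : quotCoeff f 0 j = f 0 j := by
  simp [quotCoeff]

theorem antidiagSum_zero_left (f : ℕ → ℕ → S) (j : ℕ) : antidiagSum f 0 j = f 0 j := by
  simp [antidiagSum]

theorem quotCoeff_recurrence (f : ℕ → ℕ → S) (i j : ℕ) :
    quotCoeff f (i + 2) j - 2 * quotCoeff f (i + 1) (j + 1) + quotCoeff f i (j + 2)
      = f (i + 2) j := by
  have h1 := quotCoeff_succ f (i + 1) j
  have h2 := antidiagSum_succ f i (j + 1)
  have h3 := quotCoeff_succ f i (j + 1)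
  linear_combination h1 + h2 - h3

theorem quotCoeff_zero_right [Algebra ℂ S] {f : ℕ → ℕ → S} (hf : ∀ m n, f m n = f n m)
    (h0 : ∀ i, antidiagSum f i 0 = 0) (i : ℕ) : quotCoeff f i 0 = 0 := by
  have h : quotCoeff f i 0 + quotCoeff f i 0 = ((i : S) + 2) * antidiagSum f i 0 := by
    conv_lhs => arg 1; rw [quotCoeff, ← Finset.sum_range_reflect]
    rw [quotCoeff, antidiagSum, Finset.mul_sum, ← Finset.sum_add_distrib]
    refine Finset.sum_congr rfl fun k hk => ?_
    have hk : k ≤ i := by have := Finset.mem_range.mp hk; omega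
    rw [show i + 1 - 1 - k = i - k by omega, Nat.sub_sub_self hk, zero_add, zero_add,
      hf k, Nat.cast_sub hk]
    ring
  rw [h0, mul_zero] at h
  have h2 : (2 : ℂ) • quotCoeff f i 0 = 0 := by rw [two_smul, h]
  have := congrArg (fun x => (1 / 2 : ℂ) • x) h2
  simpa [smul_smul] using this

theorem quotCoeff_one_right [Algebra ℂ S] {f : ℕ → ℕ → S} (hf : ∀ m n, f m n = f n m)
    (h0 : ∀ i, antidiagSum f i 0 = 0) (i : ℕ) : quotCoeff f i 1 = 0 := by
  have h1 := quotCoeff_zero_right hf h0 (i + 1)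
  rw [quotCoeff_succ] at h1
  have h2 := h0 (i + 1)
  rw [antidiagSum_succ] at h2
  linear_combination h1 - h2

theorem sq_mul_quot [Algebra ℂ S] {f : ℕ → ℕ → S} (hf : ∀ m n, f m n = f n m)
    (h0 : ∀ i, antidiagSum f i 0 = 0) :
    (PowerSeries.C PowerSeries.X - PowerSeries.X) ^ 2 * PowerSeries.mk (fun i =>
      PowerSeries.mk fun j => quotCoeff f i (j + 2))
      = PowerSeries.mk (fun m => PowerSeries.mk fun n => f m n) := by
  have e : (PowerSeries.C PowerSeries.X - PowerSeries.X) ^ 2 * PowerSeries.mk (fun i =>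
      PowerSeries.mk fun j => quotCoeff f i (j + 2))
      = PowerSeries.C PowerSeries.X * (PowerSeries.C PowerSeries.X * PowerSeries.mk (fun i =>
        PowerSeries.mk fun j => quotCoeff f i (j + 2)))
      - PowerSeries.X * (PowerSeries.C (2 * PowerSeries.X) * PowerSeries.mk (fun i =>
        PowerSeries.mk fun j => quotCoeff f i (j + 2)))
      + PowerSeries.X * (PowerSeries.X * PowerSeries.mk (fun i =>
        PowerSeries.mk fun j => quotCoeff f i (j + 2))) := by
    rw [map_mul, map_ofNat]
    ring
  have hX2 : ∀ i j, PowerSeries.coeff j (PowerSeries.X * (PowerSeries.X * PowerSeries.mk fun j =>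
      quotCoeff f i (j + 2))) = quotCoeff f i j := by
    intro i j
    match j with
    | 0 => rw [PowerSeries.coeff_zero_X_mul, quotCoeff_zero_right hf h0]
    | 1 => rw [PowerSeries.coeff_succ_X_mul, PowerSeries.coeff_zero_X_mul, quotCoeff_one_right hf h0]
    | j + 2 => rw [PowerSeries.coeff_succ_X_mul, PowerSeries.coeff_succ_X_mul, PowerSeries.coeff_mk]
  have hX1 : ∀ i j, PowerSeries.coeff j (2 * PowerSeries.X * PowerSeries.mk fun j =>
      quotCoeff f i (j + 2)) = 2 * quotCoeff f i (j + 1) := by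
    intro i j
    rw [mul_assoc, ← map_ofNat PowerSeries.C, PowerSeries.coeff_C_mul]
    match j with
    | 0 => rw [PowerSeries.coeff_zero_X_mul, quotCoeff_one_right hf h0]
    | j + 1 => rw [PowerSeries.coeff_succ_X_mul, PowerSeries.coeff_mk]
  rw [e]
  ext i j
  rw [map_add, map_sub, map_add, map_sub, PowerSeries.coeff_C_mul, PowerSeries.coeff_C_mul,
    PowerSeries.coeff_mk, PowerSeries.coeff_mk, PowerSeries.coeff_mk, hX2]
  match i with
  | 0 => simp [quotCoeff_zero_left]
  | 1 =>
    rw [PowerSeries.coeff_succ_X_mul, PowerSeries.coeff_succ_X_mul, PowerSeries.coeff_C_mul,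
      PowerSeries.coeff_mk, PowerSeries.coeff_zero_X_mul, hX1, quotCoeff_succ,
      quotCoeff_zero_left, antidiagSum_zero_left, map_zero, zero_add]
    ring
  | i + 2 =>
    rw [PowerSeries.coeff_succ_X_mul, PowerSeries.coeff_succ_X_mul, PowerSeries.coeff_C_mul,
      PowerSeries.coeff_mk, PowerSeries.coeff_succ_X_mul, PowerSeries.coeff_mk, hX1,
      PowerSeries.coeff_mk, quotCoeff_recurrence]

end DoubleQuotient

section ThreeVariables

variable {S : Type*} [CommRing S]

/-- A series in the first variable of `S⟦y⟧⟦z⟧⟦u⟧`. -/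
def inY (S : Type*) [CommRing S] :
    PowerSeries S →+* PowerSeries (PowerSeries (PowerSeries S)) :=
  (PowerSeries.C (R := PowerSeries (PowerSeries S))).comp (PowerSeries.C (R := PowerSeries S))

/-- A series in the second variable of `S⟦y⟧⟦z⟧⟦u⟧`. -/
def inZ (S : Type*) [CommRing S] :
    PowerSeries S →+* PowerSeries (PowerSeries (PowerSeries S)) :=
  (PowerSeries.C (R := PowerSeries (PowerSeries S))).comp
    (PowerSeries.map (PowerSeries.C (R := S)))

/-- A series in the third variable of `S⟦y⟧⟦z⟧⟦u⟧`. -/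
def inU (S : Type*) [CommRing S] :
    PowerSeries S →+* PowerSeries (PowerSeries (PowerSeries S)) :=
  (PowerSeries.map (PowerSeries.C (R := PowerSeries S))).comp
    (PowerSeries.map (PowerSeries.C (R := S)))

theorem swapVars_inY (f : PowerSeries S) : swapVars (inY S f) = inY S f := by
  simp only [inY, RingHom.comp_apply, swapVars_C, PowerSeries.map_C]

theorem swapVars_inZ (f : PowerSeries S) : swapVars (inZ S f) = inU S f := by
  simp only [inZ, inU, RingHom.comp_apply, swapVars_C]

theorem swapVars_inU (f : PowerSeries S) : swapVars (inU S f) = inZ S f := by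
  simp only [inZ, inU, RingHom.comp_apply, swapVars_map_C]

theorem inZ_X : inZ S PowerSeries.X = PowerSeries.C PowerSeries.X := by
  simp only [inZ, RingHom.comp_apply, PowerSeries.map_X]

theorem inU_X : inU S PowerSeries.X = PowerSeries.X := by
  simp only [inU, RingHom.comp_apply, PowerSeries.map_X]

theorem inZ_C (x : S) : inZ S (PowerSeries.C x) = inY S (PowerSeries.C x) := by
  simp only [inZ, inY, RingHom.comp_apply, PowerSeries.map_C]

theorem inU_C (x : S) : inU S (PowerSeries.C x) = inY S (PowerSeries.C x) := by
  simp only [inU, inY, RingHom.comp_apply, PowerSeries.map_C]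

theorem isLeftRegular_inY_sub_inZ : IsLeftRegular (inY S PowerSeries.X - inZ S PowerSeries.X) := by
  have := isLeftRegular_series_C (isLeftRegular_C_sub_X (isLeftRegular_series_X (R := S)))
  rwa [map_sub, ← inZ_X] at this

theorem isLeftRegular_inZ_sub_inU : IsLeftRegular (inZ S PowerSeries.X - inU S PowerSeries.X) := by
  have := isLeftRegular_C_sub_X (isLeftRegular_series_X (R := PowerSeries S))
  rwa [← inZ_X, ← inU_X] at this

theorem isLeftRegular_inY_sub_inU : IsLeftRegular (inY S PowerSeries.X - inU S PowerSeries.X) := by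
  have := isLeftRegular_C_sub_X (isLeftRegular_series_C (isLeftRegular_series_X (R := S)))
  rwa [← inU_X] at this

/-- The embedding `S⟦y⟧⟦u⟧ → S⟦y⟧⟦z⟧⟦u⟧`. -/
def embY (S : Type*) [CommRing S] :
    PowerSeries (PowerSeries S) →+* PowerSeries (PowerSeries (PowerSeries S)) :=
  PowerSeries.map (PowerSeries.C (R := PowerSeries S))

/-- The embedding `S⟦z⟧⟦u⟧ → S⟦y⟧⟦z⟧⟦u⟧`. -/
def embZ (S : Type*) [CommRing S] :
    PowerSeries (PowerSeries S) →+* PowerSeries (PowerSeries (PowerSeries S)) :=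
  PowerSeries.map (PowerSeries.map (PowerSeries.C (R := S)))

theorem embY_C (f : PowerSeries S) : embY S (PowerSeries.C f) = inY S f := by
  simp only [embY, inY, RingHom.comp_apply, PowerSeries.map_C]

theorem embZ_C (f : PowerSeries S) : embZ S (PowerSeries.C f) = inZ S f := by
  simp only [embZ, inZ, RingHom.comp_apply, PowerSeries.map_C]

theorem embY_map_C (f : PowerSeries S) :
    embY S (PowerSeries.map PowerSeries.C f) = inU S f := by
  simp only [embY, inU, RingHom.comp_apply]

theorem embZ_map_C (f : PowerSeries S) :
    embZ S (PowerSeries.map PowerSeries.C f) = inU S f := by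
  simp only [embZ, inU, RingHom.comp_apply, map_map_eq_C_comp]

theorem embY_X : embY S PowerSeries.X = inU S PowerSeries.X := by
  rw [inU_X, embY, PowerSeries.map_X]

theorem embZ_X : embZ S PowerSeries.X = inU S PowerSeries.X := by
  rw [inU_X, embZ, PowerSeries.map_X]

variable [Algebra ℂ S]

/-- The generating series of derivations on `S⟦y⟧⟦z⟧`. -/
def nabla₂ (D : ℕ → Derivation ℂ S S) (f : PowerSeries (PowerSeries S)) :
    PowerSeries (PowerSeries (PowerSeries S)) :=
  nabla (fun l => seriesDeriv (seriesDeriv (D l))) f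

variable (D : ℕ → Derivation ℂ S S)

theorem nabla₂_C (f : PowerSeries S) :
    nabla₂ D (PowerSeries.C f) = embY S (nabla (fun l => seriesDeriv (D l)) f) :=
  nabla_C (fun l => seriesDeriv (D l)) f

theorem nabla₂_map_C (f : PowerSeries S) :
    nabla₂ D (PowerSeries.map PowerSeries.C f)
      = embZ S (nabla (fun l => seriesDeriv (D l)) f) := by
  have h : ∀ (l : ℕ) (f : PowerSeries S),
      seriesDeriv (seriesDeriv (D l)) (PowerSeries.map (PowerSeries.C (R := S)) f)
        = PowerSeries.map (PowerSeries.C (R := S)) (seriesDeriv (D l) f) := fun l f => by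
    ext n : 1
    rw [coeff_seriesDeriv, PowerSeries.coeff_map, PowerSeries.coeff_map, seriesDeriv_C,
      coeff_seriesDeriv]
  exact nabla_map (PowerSeries.map (PowerSeries.C (R := S))) h f

theorem nabla₂_diff_sq_mul (f : PowerSeries (PowerSeries S)) :
    nabla₂ D ((PowerSeries.C PowerSeries.X - PowerSeries.X) ^ 2 * f)
      = (inY S PowerSeries.X - inZ S PowerSeries.X) ^ 2 * nabla₂ D f := by
  have h : nabla₂ D (PowerSeries.C PowerSeries.X - PowerSeries.X) = 0 := by
    have h1 : nabla₂ D (PowerSeries.C PowerSeries.X) = 0 := by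
      rw [nabla₂_C, nabla_X, map_zero]
    have h2 : nabla₂ D PowerSeries.X = 0 := nabla_X (fun l => seriesDeriv (D l))
    rw [nabla₂] at h1 h2 ⊢
    rw [nabla_sub, h1, h2, sub_zero]
  rw [nabla₂] at h ⊢
  rw [pow_two, nabla_mul, nabla_mul, h, nabla₂, map_mul, map_sub, inZ_X, inY, RingHom.comp_apply]
  ring

end ThreeVariables

section TauStructure

variable {S : Type*} [CommRing S]

/-- The series `tr R(λ) R(μ) - 1`, with `z = λ⁻¹` and `u = μ⁻¹`. -/
def traceSeries (Λ : S ≃+* S) (w : S) (α γ : PowerSeries S) : PowerSeries (PowerSeries S) :=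
  PowerSeries.C α + PowerSeries.map PowerSeries.C α
    + 2 * PowerSeries.C α * PowerSeries.map PowerSeries.C α
    - PowerSeries.C (PowerSeries.C w)
      * (PowerSeries.C (seriesShift Λ γ) * PowerSeries.map PowerSeries.C γ
        + PowerSeries.C γ * PowerSeries.map PowerSeries.C (seriesShift Λ γ))

/-- The coefficients of `traceSeries`. -/
def traceCoeff (Λ : S ≃+* S) (w : S) (α γ : PowerSeries S) (m n : ℕ) : S :=
  PowerSeries.coeff m 1 * PowerSeries.coeff n α + PowerSeries.coeff m α * PowerSeries.coeff n 1
    + 2 * (PowerSeries.coeff m α * PowerSeries.coeff n α)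
    - w * (PowerSeries.coeff m γ * PowerSeries.coeff n (seriesShift Λ γ)
      + PowerSeries.coeff m (seriesShift Λ γ) * PowerSeries.coeff n γ)

variable {Λ : S ≃+* S} {v w : S} {α γ : PowerSeries S}

theorem traceSeries_eq_mk : traceSeries Λ w α γ
    = PowerSeries.mk fun m => PowerSeries.mk fun n => traceCoeff Λ w α γ m n := by
  ext m n
  have e : traceSeries Λ w α γ = PowerSeries.C α * PowerSeries.map PowerSeries.C 1
      + PowerSeries.C 1 * PowerSeries.map PowerSeries.C α
      + PowerSeries.C (2 * α) * PowerSeries.map PowerSeries.C α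
      - PowerSeries.C (PowerSeries.C w)
        * (PowerSeries.C (seriesShift Λ γ) * PowerSeries.map PowerSeries.C γ)
      - PowerSeries.C (PowerSeries.C w)
        * (PowerSeries.C γ * PowerSeries.map PowerSeries.C (seriesShift Λ γ)) := by
    rw [traceSeries, map_one, map_one, map_mul PowerSeries.C, map_ofNat]
    ring
  rw [e]
  simp only [map_sub, map_add, PowerSeries.coeff_C_mul, PowerSeries.coeff_map,
    PowerSeries.coeff_mk, PowerSeries.coeff_mul_C, traceCoeff, one_mul]
  rw [← map_ofNat PowerSeries.C, PowerSeries.coeff_C_mul]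
  simp only [PowerSeries.coeff_C, PowerSeries.coeff_one]
  split_ifs <;> ring

theorem traceCoeff_comm (m n : ℕ) : traceCoeff Λ w α γ m n = traceCoeff Λ w α γ n m := by
  rw [traceCoeff, traceCoeff]
  ring

theorem antidiagSum_traceCoeff (h : IsTodaResolvent Λ v w α γ) (i : ℕ) :
    antidiagSum (traceCoeff Λ w α γ) i 0 = 0 := by
  have e : antidiagSum (traceCoeff Λ w α γ) i 0
      = ∑ p ∈ antidiagonal i, traceCoeff Λ w α γ p.2 p.1 := by
    rw [Finset.Nat.sum_antidiagonal_eq_sum_range_succ fun k l => traceCoeff Λ w α γ l k,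
      antidiagSum]
    simp
  have hq := congrArg (PowerSeries.coeff i) h.quadratic
  rw [pow_two, mul_assoc, map_add, PowerSeries.coeff_C_mul] at hq
  have h1 : PowerSeries.coeff i α = PowerSeries.coeff i (α * 1) := by rw [mul_one]
  have h2 : PowerSeries.coeff i α = PowerSeries.coeff i (1 * α) := by rw [one_mul]
  have h3 : PowerSeries.coeff i (γ * seriesShift Λ γ)
    = PowerSeries.coeff i (seriesShift Λ γ * γ) := by rw [mul_comm]
  rw [e]
  simp only [traceCoeff, Finset.sum_sub_distrib, Finset.sum_add_distrib, ← Finset.mul_sum]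
  have s : ∀ f g : PowerSeries S, ∑ p ∈ antidiagonal i, PowerSeries.coeff p.2 f
      * PowerSeries.coeff p.1 g = PowerSeries.coeff i (f * g) := fun f g => by
    rw [mul_comm f, PowerSeries.coeff_mul]
    exact Finset.sum_congr rfl fun _ _ => mul_comm _ _
  rw [s, s, s, s, s, ← h1, ← h2, ← h3]
  linear_combination 2 * hq

section Generating

variable {sh : ℤ → S → S} (h₁ : ∀ f, sh 1 f = Λ f)
include h₁

theorem trace_todaRes (m n : ℕ) : (todaRes sh v w m * todaRes sh v w (n + 1)).trace
    = traceCoeff Λ w (todaAlpha sh v w) (todaGamma sh v w) m (n + 1) := by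
  cases m with
  | zero => simp [todaRes, traceCoeff, Matrix.trace_fin_two,
      PowerSeries.coeff_one, todaAlpha, todaGamma]
  | succ m =>
    simp [todaRes, traceCoeff, Matrix.trace_fin_two, coeff_succ_todaAlpha,
      coeff_succ_todaGamma, PowerSeries.coeff_one, todaB, h₁]
    ring

theorem todaOmega_eq_quotCoeff (i j : ℕ) : todaOmega sh v w i j
    = quotCoeff (traceCoeff Λ w (todaAlpha sh v w) (todaGamma sh v w)) i (j + 2) := by
  rw [todaOmega, quotCoeff]
  refine Finset.sum_congr rfl fun k _ => ?_
  rw [show j + 2 + k = j + k + 1 + 1 by omega, trace_todaRes h₁]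

end Generating

/-- The generating series of the tau-structure. -/
def omegaSeries (sh : ℤ → S → S) (v w : S) : PowerSeries (PowerSeries S) :=
  PowerSeries.mk fun i => PowerSeries.mk fun j => todaOmega sh v w i j

theorem isLeftRegular_C_X_sub_X :
    IsLeftRegular (PowerSeries.C PowerSeries.X - PowerSeries.X : PowerSeries (PowerSeries S)) :=
  isLeftRegular_C_sub_X isLeftRegular_series_X

theorem nabla₂_traceSeries [Algebra ℂ S] (D : ℕ → Derivation ℂ S S) :
    nabla₂ D (traceSeries Λ w α γ)
      = embZ S (nabla (fun l => seriesDeriv (D l)) α) * (1 + 2 * inY S α)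
        + embY S (nabla (fun l => seriesDeriv (D l)) α) * (1 + 2 * inZ S α)
        - nabla₂ D (PowerSeries.C (PowerSeries.C w))
          * (inZ S (seriesShift Λ γ) * inY S γ + inZ S γ * inY S (seriesShift Λ γ))
        - inY S (PowerSeries.C w)
          * (embZ S (nabla (fun l => seriesDeriv (D l)) (seriesShift Λ γ)) * inY S γ
            + inZ S (seriesShift Λ γ) * embY S (nabla (fun l => seriesDeriv (D l)) γ)
            + embZ S (nabla (fun l => seriesDeriv (D l)) γ) * inY S (seriesShift Λ γ)
            + inZ S γ * embY S (nabla (fun l => seriesDeriv (D l)) (seriesShift Λ γ))) := by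
  have h2 : (2 : PowerSeries (PowerSeries S)) = 1 + 1 := one_add_one_eq_two.symm
  simp only [← nabla₂_C, ← nabla₂_map_C, nabla₂]
  rw [traceSeries, h2]
  simp only [nabla_sub, nabla_add, nabla_mul, nabla_one, map_mul, map_add, map_one, inY, inZ,
    RingHom.comp_apply]
  ring

variable [Algebra ℂ S] {sh : ℤ → S → S} (h₁ : ∀ f, sh 1 f = Λ f)
  (h₂ : ∀ f, sh (-1) f = Λ.symm f)
include h₁ h₂

theorem sq_mul_omegaSeries :
    (PowerSeries.C PowerSeries.X - PowerSeries.X) ^ 2 * omegaSeries sh v w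
      = traceSeries Λ w (todaAlpha sh v w) (todaGamma sh v w) := by
  rw [traceSeries_eq_mk, ← sq_mul_quot traceCoeff_comm
    (antidiagSum_traceCoeff (isTodaResolvent (v := v) (w := w) h₁ h₂)), omegaSeries]
  simp only [todaOmega_eq_quotCoeff h₁]

theorem todaOmega_comm (i j : ℕ) : todaOmega sh v w i j = todaOmega sh v w j i := by
  have h : swapVars (omegaSeries sh v w) = omegaSeries sh v w := by
    apply (isLeftRegular_C_X_sub_X.mul isLeftRegular_C_X_sub_X)
    have e := congrArg swapVars (sq_mul_omegaSeries (v := v) (w := w) h₁ h₂)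
    have e' := sq_mul_omegaSeries (v := v) (w := w) h₁ h₂
    have s : swapVars (traceSeries Λ w (todaAlpha sh v w) (todaGamma sh v w))
        = traceSeries Λ w (todaAlpha sh v w) (todaGamma sh v w) := by
      rw [traceSeries_eq_mk]
      ext m n
      rw [coeff_swapVars]
      simp only [PowerSeries.coeff_mk]
      exact traceCoeff_comm _ _
    rw [s, ← e', map_mul, map_pow, map_sub, swapVars_X, swapVars_C, PowerSeries.map_X] at e
    simp only
    linear_combination e
  have := congrArg (fun f => PowerSeries.coeff j (PowerSeries.coeff i f)) h
  simpa [coeff_swapVars, omegaSeries] using this.symm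

variable {D : ℕ → Derivation ℂ S S}
  (hD : IsTodaFlow Λ v w (todaAlpha sh v w) (todaGamma sh v w) D)
include hD

theorem derivation_shift_todaC (l k : ℕ) : D l (Λ (todaC sh v w (k + 1)))
    = Λ (todaOmega sh v w l k) - todaOmega sh v w l k := by
  have h := isTodaResolvent (v := v) (w := w) h₁ h₂
  have hlz := congrArg (PowerSeries.C (R := PowerSeries S)) h.linear
  have hfz := congrArg (PowerSeries.C (R := PowerSeries S)) h.linear_fst
  have hlu := congrArg (PowerSeries.map (PowerSeries.C (R := S))) h.linear
  have hfu := congrArg (PowerSeries.map (PowerSeries.C (R := S))) h.linear_fst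
  simp only [map_mul, map_sub, map_add, map_one, PowerSeries.map_X, PowerSeries.map_C]
    at hlz hfz hlu hfu
  have hg := congrArg (PowerSeries.map (seriesShift Λ)) (hD.nabla_resolvent h).2
  simp only [map_sub, map_mul, map_add, map_one, map_ofNat, ← hD.nabla_seriesShift,
    PowerSeries.map_X, PowerSeries.map_C, map_map_eq_C_comp] at hg
  have key := tau_structure_shift hg hlz hlu hfz hfu
  have hΩ := sq_mul_omegaSeries (v := v) (w := w) h₁ h₂
  have hΩ' := congrArg (PowerSeries.map (seriesShift Λ)) hΩ
  simp only [traceSeries, map_sub, map_mul, map_add, map_pow, map_ofNat, PowerSeries.map_X,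
    PowerSeries.map_C, map_map_eq_C_comp, RingHom.coe_coe] at hΩ'
  rw [traceSeries] at hΩ
  rw [← hΩ, ← hΩ', ← mul_sub, mul_left_comm] at key
  have key := (isLeftRegular_C_X_sub_X.pow 2) key
  have := congrArg (fun f => PowerSeries.coeff (k + 2) (PowerSeries.coeff (l + 2) f)) key
  simp only [coeff_nabla, coeff_seriesDeriv, coeff_seriesShift, coeff_succ_todaGamma, mul_assoc]
    at this
  rw [this, mul_comm (PowerSeries.X ^ 2), ← map_pow, mul_assoc, PowerSeries.coeff_C_mul,
    PowerSeries.coeff_mul_X_pow, mul_comm, PowerSeries.coeff_mul_X_pow]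
  simp [omegaSeries]

theorem derivation_todaOmega_comm (l i j : ℕ) :
    D l (todaOmega sh v w i j) = D i (todaOmega sh v w l j) := by
  have h := isTodaResolvent (v := v) (w := w) h₁ h₂
  have hlz := congrArg (PowerSeries.C (R := PowerSeries S)) h.linear
  have hlu := congrArg (PowerSeries.map (PowerSeries.C (R := S))) h.linear
  simp only [map_mul, map_sub, map_add, map_one, PowerSeries.map_X, PowerSeries.map_C]
    at hlz hlu
  obtain ⟨ha, hg⟩ := hD.nabla_resolvent h
  have hg' := congrArg (PowerSeries.map (seriesShift Λ)) hg
  simp only [map_sub, map_mul, map_add, map_one, map_ofNat, ← hD.nabla_seriesShift,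
    PowerSeries.map_X, PowerSeries.map_C, map_map_eq_C_comp] at hg'
  have hg' := flow_linear' hg' hlz hlu
  have hay := congrArg (embY S) ha
  have haz := congrArg (embZ S) ha
  have hgy := congrArg (embY S) hg
  have hgz := congrArg (embZ S) hg
  have hgy' := congrArg (embY S) hg'
  have hgz' := congrArg (embZ S) hg'
  simp only [map_sub, map_mul, map_add, map_one, map_ofNat, embY_X, embY_C, embY_map_C]
    at hay hgy hgy'
  simp only [map_sub, map_mul, map_add, map_one, map_ofNat, embZ_X, embZ_C, embZ_map_C]
    at haz hgz hgz'
  rw [inZ_C] at haz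
  have hw : nabla₂ D (PowerSeries.C (PowerSeries.C w)) = inY S (PowerSeries.C w)
      * (inU S (seriesShift Λ (todaGamma sh v w)) - inU S (todaGamma sh v w)) := by
    rw [nabla₂_C, nabla_C, hD.snd, embY_map_C, map_mul, map_sub, inU_C]
  have hF := congrArg (nabla₂ D) (sq_mul_omegaSeries (v := v) (w := w) h₁ h₂)
  rw [nabla₂_diff_sq_mul, nabla₂_traceSeries] at hF
  have key := tau_structure_flow haz hay hgz hgy hgz' hgy' hw hF
  set M : PowerSeries (PowerSeries (PowerSeries S)) :=
    PowerSeries.mk fun l => seriesDeriv (seriesDeriv (D l)) (omegaSeries sh v w) with hM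
  have hΩ : nabla₂ D (omegaSeries sh v w) = inU S PowerSeries.X ^ 2 * M := by
    rw [inU_X, nabla₂, nabla]
  rw [hΩ] at key
  have hU : IsLeftRegular (inU S PowerSeries.X) := by
    rw [inU_X]
    exact isLeftRegular_series_X
  have key' := cancel_sub_mul_sq isLeftRegular_inY_sub_inZ hU key
  have hswap := congrArg swapVars key'
  simp only [map_mul, map_sub, map_add, map_one, map_ofNat, swapVars_inY, swapVars_inZ,
    swapVars_inU] at hswap
  have hsym : swapVars M = M :=
    (isLeftRegular_inY_sub_inZ.mul (isLeftRegular_inZ_sub_inU.mul isLeftRegular_inY_sub_inU)) (by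
      simp only
      linear_combination -hswap - key')
  have := congrArg (fun f => PowerSeries.coeff j (PowerSeries.coeff i (PowerSeries.coeff l f))) hsym
  simp only [coeff_swapVars, hM, PowerSeries.coeff_mk, coeff_seriesDeriv, omegaSeries] at this
  exact this.symm

end TauStructure

section Potential

variable {K : Type*} [CommRing K] [Algebra ℂ K]

theorem inv_smul_mul_natCast_add_one (z : K) (n : ℕ) :
    ((n : ℂ) + 1)⁻¹ • (z * ((n : K) + 1)) = z := by
  have : z * ((n : K) + 1) = ((n : ℂ) + 1) • z := by
    rw [Algebra.smul_def, map_add, map_natCast, map_one, mul_comm]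
  rw [this, smul_smul, inv_mul_cancel₀ (Nat.cast_add_one_ne_zero n), one_smul]

theorem mul_natCast_add_one_cancel {x y : K} {n : ℕ} (h : x * ((n : K) + 1) = y * ((n : K) + 1)) :
    x = y := by
  rw [← inv_smul_mul_natCast_add_one x n, h, inv_smul_mul_natCast_add_one]

theorem exists_eq_add_single {m : ℕ →₀ ℕ} (hm : m ≠ 0) :
    ∃ (n : ℕ →₀ ℕ) (k : ℕ), m = n + Finsupp.single k 1 := by
  obtain ⟨k, hk⟩ := Finsupp.ne_iff.mp hm
  refine ⟨m - Finsupp.single k 1, k, (tsub_add_cancel_of_le ?_).symm⟩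
  rw [Finsupp.single_le_iff]
  exact Nat.one_le_iff_ne_zero.mpr hk

/-- The Poincaré lemma for the variables `t_k`, `k > 0`. -/
theorem exists_mvPowerSeries_potential (f₀ : K) (Z : ℕ → MvPowerSeries ℕ K)
    (hZ : ∀ j k, MvPowerSeries.pderiv K j (Z k) = MvPowerSeries.pderiv K k (Z j)) :
    ∃ T : MvPowerSeries ℕ K, MvPowerSeries.coeff 0 T = f₀ ∧
      ∀ (k : ℕ) (n : ℕ →₀ ℕ), MvPowerSeries.coeff (n + Finsupp.single k 1) T * ((n k : K) + 1)
        = MvPowerSeries.coeff n (Z k) := by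
  classical
  choose N κ hN using fun (m : ℕ →₀ ℕ) (hm : m ≠ 0) => exists_eq_add_single hm
  let T : MvPowerSeries ℕ K := fun m => if hm : m = 0 then f₀ else
    ((N m hm (κ m hm) : ℂ) + 1)⁻¹ • MvPowerSeries.coeff (N m hm) (Z (κ m hm))
  have hT : ∀ m (hm : m ≠ 0), MvPowerSeries.coeff m T * ((N m hm (κ m hm) : K) + 1)
      = MvPowerSeries.coeff (N m hm) (Z (κ m hm)) := fun m hm => by
    have : MvPowerSeries.coeff m T
        = ((N m hm (κ m hm) : ℂ) + 1)⁻¹ • MvPowerSeries.coeff (N m hm) (Z (κ m hm)) := dif_neg hm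
    rw [this, smul_mul_assoc, inv_smul_mul_natCast_add_one]
  have hT0 : MvPowerSeries.coeff 0 T = f₀ := by
    change T 0 = f₀
    simp [T]
  refine ⟨T, hT0, fun k n => ?_⟩
  have hm : n + Finsupp.single k 1 ≠ 0 := fun h => by
    have := DFunLike.congr_fun h k
    simp at this
  have h1 := hT _ hm
  have h2 := hN _ hm
  generalize N _ hm = n' at h1 h2
  generalize κ _ hm = k' at h1 h2
  by_cases hk : k = k'
  · subst hk
    obtain rfl : n = n' := add_left_injective _ h2
    exact h1
  · obtain ⟨p, rfl⟩ : ∃ p, n = p + Finsupp.single k' 1 := by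
      refine ⟨n - Finsupp.single k' 1, (tsub_add_cancel_of_le ?_).symm⟩
      have := DFunLike.congr_fun h2 k'
      simp [hk] at this
      rw [Finsupp.single_le_iff, this]
      exact Nat.le_add_left 1 _
    have h3 : n' = p + Finsupp.single k 1 := by
      rw [add_right_comm] at h2
      exact (add_left_injective _ h2).symm
    have h4 := congrArg (MvPowerSeries.coeff p) (hZ k k')
    rw [MvPowerSeries.coeff_pderiv, MvPowerSeries.coeff_pderiv] at h4
    subst h3
    simp only [Finsupp.add_apply, Finsupp.single_apply, hk, Ne.symm hk, if_false, add_zero] at h1 ⊢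
    apply mul_natCast_add_one_cancel (n := p k')
    rw [mul_right_comm, h1, h4]

variable {dx dX : Derivation ℂ K K}
  (hexact : ∀ a b : K, dX a = dx b → ∃ f : K, dx f = a ∧ dX f = b)
include hexact

/-- The Poincaré lemma for `Ser K`. -/
theorem exists_potential {Z : Ser K} {Zt : ℕ → Ser K}
    (h₁ : ∀ k, serDeriv dx (Zt k) = dt dX k Z) (h₂ : ∀ j k, dt dX j (Zt k) = dt dX k (Zt j)) :
    ∃ T : Ser K, serDeriv dx T = Z ∧ ∀ k, dt dX k T = Zt k := by
  have h₁' : ∀ n k, mapDeriv dx (PowerSeries.coeff n (Zt k))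
      = dtCoeff dX k (PowerSeries.coeff n Z) := fun n k => by
    rw [← coeff_dt, ← h₁]
    rfl
  have h₂' : ∀ n j k, dtCoeff dX j (PowerSeries.coeff n (Zt k))
      = dtCoeff dX k (PowerSeries.coeff n (Zt j)) := fun n j k => by
    rw [← coeff_dt, h₂, coeff_dt]
  have key : ∀ n, ∃ T : MvPowerSeries ℕ K, mapDeriv dx T = PowerSeries.coeff n Z ∧
      ∀ k, dtCoeff dX k T = PowerSeries.coeff n (Zt k) := fun n => by
    obtain ⟨f₀, hfx, hfX⟩ := hexact
      (MvPowerSeries.coeff 0 (PowerSeries.coeff n Z))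
      (MvPowerSeries.coeff 0 (PowerSeries.coeff n (Zt 0)))
      (congrArg (MvPowerSeries.coeff 0) (h₁' n 0)).symm
    obtain ⟨T, hT0, hT⟩ := exists_mvPowerSeries_potential f₀
      (fun k => PowerSeries.coeff n (Zt (k + 1))) (fun j k => h₂' n (j + 1) (k + 1))
    refine ⟨T, ?_, fun k => ?_⟩
    · ext m
      rw [mvCoeff_mapDeriv]
      by_cases hm : m = 0
      · rw [hm, hT0, hfx]
      · obtain ⟨p, k, rfl⟩ := exists_eq_add_single hm
        apply mul_natCast_add_one_cancel (n := p k)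
        rw [← derivation_mul_natCast_add_one, hT, ← coeff_dtCoeff_succ dX, ← h₁',
          mvCoeff_mapDeriv]
    · ext m
      match k with
      | 0 =>
        rw [coeff_dtCoeff_zero]
        by_cases hm : m = 0
        · rw [hm, hT0, hfX]
        · obtain ⟨p, k, rfl⟩ := exists_eq_add_single hm
          apply mul_natCast_add_one_cancel (n := p k)
          rw [← derivation_mul_natCast_add_one, hT, ← coeff_dtCoeff_succ dX, ← h₂',
            coeff_dtCoeff_zero]
      | k + 1 => rw [coeff_dtCoeff_succ, hT]
  choose T hTx hTt using key
  refine ⟨PowerSeries.mk T, ?_, fun k => ?_⟩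
  · ext1 n
    rw [← hTx n]
    change mapDeriv dx (PowerSeries.coeff n (PowerSeries.mk T)) = _
    rw [PowerSeries.coeff_mk]
  · ext1 n
    rw [coeff_dt, PowerSeries.coeff_mk, hTt]

/-- The Poincaré lemma with the derivative along `x` replaced by the difference operator `Λ - 1`. -/
theorem exists_shift_potential (hcomm : ∀ g, dx (dX g) = dX (dx g)) {A : Ser K} {Z : ℕ → Ser K}
    (h₁ : ∀ k, shift dx 1 (Z k) - Z k = eps * dt dX k A)
    (h₂ : ∀ j k, dt dX j (Z k) = dt dX k (Z j)) :
    ∃ T : Ser K, shift dx 1 T - T = eps * A ∧ ∀ k, dt dX k T = Z k := by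
  obtain ⟨p, hp⟩ := exists_expQuot_inv
  obtain ⟨T, hTx, hTt⟩ := exists_potential hexact (Z := opSeries (mapDeriv dx) p A) (Zt := Z)
    (fun k => by
      have h := h₁ k
      rw [shift_sub_self] at h
      have h := eps_mul_cancel h
      rw [← opSeries_dt hcomm, ← h, opSeries_serDeriv, ← opSeries_mul, mul_comm, hp,
        opSeries_one]) h₂
  refine ⟨T, ?_, hTt⟩
  rw [shift_sub_self, ← opSeries_serDeriv, hTx, ← opSeries_mul, hp, opSeries_one]

end Potential

section TodaToNLS

variable {K : Type*} [CommRing K] [Algebra ℂ K] {dx dX : Derivation ℂ K K} {v w : Ser K}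

theorem todaA_shift_one : todaA (shift dx) v w 1 = w := by
  rw [todaA_succ]
  simp [todaC_zero, todaA_zero, (shiftEquiv_apply dx 1).symm]

theorem todaC_shift_one : todaC (shift dx) v w 1 = shift dx (-1) v := by
  rw [todaC_succ, todaC_zero, todaA_zero]
  simp [(shiftEquiv_symm_apply dx 0).symm]

theorem shift_todaC_shift_one : shift dx 1 (todaC (shift dx) v w 1) = v := by
  rw [todaC_shift_one, shift_shift]
  exact shift_zero dx v

theorem IsDifferenceSolution.jetCoeff_eq (hcomm : ∀ g, dx (dX g) = dX (dx g))
    (h : IsDifferenceSolution dx dX v w) (k : ℕ) :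
    jetCoeff (fun f => eps * dt dX 0 f) v w k
      = (todaA (shift dx) v w k, shift dx 1 (todaC (shift dx) v w k),
        w * todaC (shift dx) v w k) :=
  jetCoeff_eq_toda (Λ := shiftEquiv dx) (shiftEquiv_apply dx) (shiftEquiv_symm_apply dx)
    (D := (eps : Ser K) • dt dX 0) (fun f => by
      simp only [Derivation.smul_apply, smul_eq_mul, shiftEquiv_apply]
      rw [← shift_dt hcomm, shift_eps_mul])
    h.1.symm h.2.symm k

theorem IsTodaSolution.isDifferenceSolution (h : IsTodaSolution dx dX v w) :
    IsDifferenceSolution dx dX v w := by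
  obtain ⟨h1, h2⟩ := h 0
  rw [todaA_shift_one] at h1
  rw [shift_todaC_shift_one, todaC_shift_one] at h2
  exact ⟨h1.symm, h2.symm⟩

theorem IsTodaSolution.isTodaFlow (hcomm : ∀ g, dx (dX g) = dX (dx g))
    (h : IsTodaSolution dx dX v w) :
    IsTodaFlow (shiftEquiv dx) v w (todaAlpha (shift dx) v w) (todaGamma (shift dx) v w)
      (fun l => (eps : Ser K) • dt dX l) where
  comm l f := by
    simp only [Derivation.smul_apply, smul_eq_mul, shiftEquiv_apply]
    rw [← shift_dt hcomm, shift_eps_mul]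
  fst := by
    ext1 n
    match n with
    | 0 => simp [nabla, todaAlpha, constantCoeff_seriesShift]
    | 1 =>
      rw [map_sub, coeff_seriesShift, coeff_succ_todaAlpha, todaA_zero, map_zero, sub_zero, nabla,
        PowerSeries.coeff_X_pow_mul', if_neg (by norm_num)]
    | l + 2 =>
      rw [coeff_nabla, map_sub, coeff_seriesShift, coeff_succ_todaAlpha]
      exact (h l).1
  snd := by
    ext1 n
    match n with
    | 0 => simp [nabla, todaGamma, constantCoeff_seriesShift]
    | 1 =>
      rw [PowerSeries.coeff_C_mul, map_sub, coeff_seriesShift, coeff_succ_todaGamma, todaC_zero,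
        map_one, sub_self, mul_zero, nabla, PowerSeries.coeff_X_pow_mul', if_neg (by norm_num)]
    | l + 2 =>
      rw [coeff_nabla, PowerSeries.coeff_C_mul, map_sub, coeff_seriesShift, coeff_succ_todaGamma]
      exact (h l).2

theorem todaOmega_shift_comm (i j : ℕ) :
    todaOmega (shift dx) v w i j = todaOmega (shift dx) v w j i :=
  todaOmega_comm (Λ := shiftEquiv dx) (shiftEquiv_apply dx) (shiftEquiv_symm_apply dx) i j

section TauStructureOfSolution

variable (hcomm : ∀ g, dx (dX g) = dX (dx g)) (h : IsTodaSolution dx dX v w)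
include hcomm h

theorem IsTodaSolution.dt_shift_todaC (l k : ℕ) :
    eps * dt dX l (shift dx 1 (todaC (shift dx) v w (k + 1)))
      = shift dx 1 (todaOmega (shift dx) v w l k) - todaOmega (shift dx) v w l k :=
  derivation_shift_todaC (Λ := shiftEquiv dx) (shiftEquiv_apply dx) (shiftEquiv_symm_apply dx)
    (h.isTodaFlow hcomm) l k

theorem IsTodaSolution.dt_omega_comm (l i j : ℕ) :
    dt dX l (todaOmega (shift dx) v w i j) = dt dX i (todaOmega (shift dx) v w l j) :=
  eps_mul_cancel (derivation_todaOmega_comm (Λ := shiftEquiv dx) (shiftEquiv_apply dx)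
    (shiftEquiv_symm_apply dx) (h.isTodaFlow hcomm) l i j)

theorem IsTodaSolution.dt_shift_todaC_comm (j k : ℕ) :
    dt dX j (shift dx 1 (todaC (shift dx) v w (k + 1)))
      = dt dX k (shift dx 1 (todaC (shift dx) v w (j + 1))) := by
  apply eps_mul_cancel
  rw [h.dt_shift_todaC hcomm, h.dt_shift_todaC hcomm, todaOmega_shift_comm]

theorem IsTodaSolution.nlsOmegaAt_eq {L φ : Ser K} (hφ : IsEpsLogQ dx dX v w L φ) (i j : ℕ) :
    nlsOmegaAt dX φ w i j = LaurentPolynomial.C (todaOmega (shift dx) v w i j) :=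
  nlsOmega_eq_todaOmega (dt dX 0) (by rw [hφ.2 0, shift_todaC_shift_one])
    (h.isDifferenceSolution.jetCoeff_eq hcomm) i j

theorem IsTodaSolution.exists_epsLogQ
    (hexact : ∀ a b : K, dX a = dx b → ∃ f : K, dx f = a ∧ dX f = b)
    {L : Ser K} (hL : IsLogOf dx dX L w) : ∃ φ, IsEpsLogQ dx dX v w L φ := by
  obtain ⟨φ, hφ, hφt⟩ := exists_shift_potential hexact hcomm (A := shift dx 1 L)
    (Z := fun k => shift dx 1 (todaC (shift dx) v w (k + 1)))
    (fun k => by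
      have e : shift dx 1 (todaC (shift dx) v w (k + 1)) - todaC (shift dx) v w (k + 1)
          = eps * dt dX k L := by
        apply hL.1.mul_left_cancel
        rw [mul_left_comm, hL.2.2, (h k).2]
      rw [← shift_dt hcomm, ← shift_eps_mul, ← e]
      exact (map_sub (shiftEquiv dx) _ _).symm)
    (h.dt_shift_todaC_comm hcomm)
  refine ⟨φ, ?_, hφt⟩
  have := congrArg (shiftEquiv dx).symm hφ
  rw [map_sub, shiftEquiv_symm_apply, shiftEquiv_symm_apply, shiftEquiv_symm_apply, shift_shift,
    shift_eps_mul, shift_shift] at this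
  simpa only [neg_add_cancel, shift_zero] using this

theorem IsTodaSolution.exists_nlsTau
    (hexact : ∀ a b : K, dX a = dx b → ∃ f : K, dx f = a ∧ dX f = b)
    {L φ : Ser K} (hφ : IsEpsLogQ dx dX v w L φ) : ∃ T, IsNLSTau dx dX v w φ T := by
  choose Y hYx hYt using fun k => exists_shift_potential hexact hcomm
    (A := shift dx 1 (todaC (shift dx) v w (k + 1)))
    (Z := fun i => todaOmega (shift dx) v w i k)
    (fun i => (h.dt_shift_todaC hcomm i k).symm) (fun j i => h.dt_omega_comm hcomm j i k)
  obtain ⟨T, hTx, hTt⟩ := exists_shift_potential hexact hcomm (A := φ) (Z := Y)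
    (fun k => by rw [hYx, hφ.2])
    (fun j k => by rw [hYt, hYt, todaOmega_shift_comm])
  refine ⟨T, fun i j => ?_, fun k => by rw [hTt, hYx], ?_⟩
  · rw [h.nlsOmegaAt_eq hcomm hφ, hTt, hYt]
  · have e := congrArg (shiftEquiv dx).symm hTx
    rw [map_sub, shiftEquiv_symm_apply, shiftEquiv_symm_apply, shiftEquiv_symm_apply, shift_shift,
      shift_eps_mul, neg_add_cancel, shift_zero] at e
    linear_combination hTx - e

theorem IsTodaSolution.isTodaTau {L φ T : Ser K} (hφ : IsEpsLogQ dx dX v w L φ)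
    (hT : IsNLSTau dx dX v w φ T) : IsTodaTau dx dX v w L T := by
  refine ⟨fun i j => ?_, fun i => ?_, ?_⟩
  · have e := hT.1 i j
    rw [h.nlsOmegaAt_eq hcomm hφ] at e
    apply C_mul_T_inj (n := 0)
    rw [e]
  · rw [map_sub, ← shift_dt hcomm, hT.2.1]
  · rw [hT.2.2, hφ.1]
    ring

end TauStructureOfSolution

theorem IsEpsLogQ.sub_eq_zero {L φ φ' : Ser K} (h : IsEpsLogQ dx dX v w L φ)
    (h' : IsEpsLogQ dx dX v w L φ') :
    serDeriv dx (φ' - φ) = 0 ∧ ∀ k : ℕ, dt dX k (φ' - φ) = 0 := by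
  refine ⟨?_, fun k => by rw [map_sub, h.2, h'.2, sub_self]⟩
  obtain ⟨p, hp⟩ := exists_expQuot_inv
  have e : ∀ {ψ : Ser K}, IsEpsLogQ dx dX v w L ψ → shift dx 1 ψ - ψ = eps * shift dx 1 L :=
    fun {ψ} hψ => by
      have := congrArg (shiftEquiv dx) hψ.1
      rw [map_sub, shiftEquiv_apply, shiftEquiv_apply, shiftEquiv_apply, shift_shift,
        shift_eps_mul] at this
      simpa only [add_neg_cancel, shift_zero] using this
  have e₁ := e h
  have e₂ := e h'
  rw [shift_sub_self, ← opSeries_serDeriv] at e₁ e₂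
  have e₃ := congrArg (opSeries (mapDeriv dx) p) (eps_mul_cancel (e₂.trans e₁.symm))
  rw [← opSeries_mul, ← opSeries_mul, mul_comm, hp, opSeries_one, opSeries_one] at e₃
  rw [map_sub, e₃, sub_self]

end TodaToNLS

section TimeIdeal

/-- The element of `Ser K` with given coefficients. -/
def serMk {K : Type*} [CommRing K] (c : ℕ → (ℕ →₀ ℕ) → K) : Ser K :=
  PowerSeries.mk fun e => (c e : MvPowerSeries ℕ K)

theorem coeff_serMk {K : Type*} [CommRing K] (c : ℕ → (ℕ →₀ ℕ) → K) (e : ℕ) (m : ℕ →₀ ℕ) :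
    MvPowerSeries.coeff m (PowerSeries.coeff e (serMk c)) = c e m :=
  congrArg (MvPowerSeries.coeff m) (PowerSeries.coeff_mk (R := MvPowerSeries ℕ K) e c)

variable {K : Type*} [CommRing K]

/-- The ideal of `Ser K` generated by the `n`-th power of the variable `t_{k+1}`. -/
def timeIdeal (K : Type*) [CommRing K] (k n : ℕ) : Ideal (Ser K) where
  carrier := {f | ∀ (e : ℕ) (m : ℕ →₀ ℕ), m k < n →
    MvPowerSeries.coeff m (PowerSeries.coeff e f) = 0}
  zero_mem' e m _ := by simp
  add_mem' {f g} hf hg e m hm := by rw [map_add, map_add, hf e m hm, hg e m hm, add_zero]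
  smul_mem' c f hf e m hm := by
    classical
    rw [smul_eq_mul, PowerSeries.coeff_mul, map_sum]
    refine Finset.sum_eq_zero fun ij _ => ?_
    rw [MvPowerSeries.coeff_mul]
    refine Finset.sum_eq_zero fun p hp => ?_
    have h := DFunLike.congr_fun (mem_antidiagonal.mp hp) k
    rw [Finsupp.add_apply] at h
    rw [hf ij.2 p.2 (by omega), mul_zero]

theorem mem_timeIdeal_zero (k : ℕ) (f : Ser K) : f ∈ timeIdeal K k 0 :=
  fun _ _ hm => absurd hm (Nat.not_lt_zero _)

theorem eq_zero_of_mem_timeIdeal {k : ℕ} {f : Ser K} (h : ∀ n, f ∈ timeIdeal K k n) : f = 0 := by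
  ext e m
  exact h (m k + 1) e m (Nat.lt_succ_self _)

theorem timeIdeal_anti (k : ℕ) {n n' : ℕ} (h : n ≤ n') : timeIdeal K k n' ≤ timeIdeal K k n :=
  fun _ hf e m hm => hf e m (hm.trans_le h)

theorem mem_timeIdeal_of_eps_mul {k n : ℕ} {f : Ser K} (h : eps * f ∈ timeIdeal K k n) :
    f ∈ timeIdeal K k n := fun e m hm => by
  have := h (e + 1) m hm
  rwa [eps, PowerSeries.coeff_succ_X_mul] at this

theorem serMap_mem_timeIdeal {K' : Type*} [CommRing K'] (F : K →+* K') {k n : ℕ} {f : Ser K}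
    (h : f ∈ timeIdeal K k n) : serMap F f ∈ timeIdeal K' k n := fun e m hm => by
  rw [coeff_serMap, MvPowerSeries.coeff_map, h e m hm, map_zero]

variable [Algebra ℂ K] {k n : ℕ} {f : Ser K}

theorem opSeries_mem_timeIdeal (d : Derivation ℂ K K) (p : PowerSeries ℂ)
    (h : f ∈ timeIdeal K k n) : opSeries (mapDeriv d) p f ∈ timeIdeal K k n := fun e m hm => by
  have hi : ∀ (i : ℕ) (g : MvPowerSeries ℕ K), MvPowerSeries.coeff m ((⇑(mapDeriv d))^[i] g)
      = (⇑d)^[i] (MvPowerSeries.coeff m g) := fun i g =>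
    Function.Semiconj.iterate_right (f := MvPowerSeries.coeff m) (fun g => rfl) i g
  rw [coeff_opSeries, map_sum]
  refine Finset.sum_eq_zero fun ij _ => ?_
  change PowerSeries.coeff ij.1 p • MvPowerSeries.coeff m ((⇑(mapDeriv d))^[ij.1] _) = 0
  rw [hi, h _ m hm, iterate_map_zero, smul_zero]

theorem serDeriv_mem_timeIdeal (d : Derivation ℂ K K) (h : f ∈ timeIdeal K k n) :
    serDeriv d f ∈ timeIdeal K k n := fun e m hm =>
  (congrArg d (h e m hm)).trans (map_zero d)

theorem shift_mem_timeIdeal (dx : Derivation ℂ K K) (s : ℤ) (h : f ∈ timeIdeal K k n) :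
    shift dx s f ∈ timeIdeal K k n := by
  rw [shift_eq_opSeries]
  exact opSeries_mem_timeIdeal _ _ h

theorem mem_timeIdeal_iff_shiftEquiv (dx : Derivation ℂ K K) (f : Ser K) :
    f ∈ timeIdeal K k n ↔ shiftEquiv dx f ∈ timeIdeal K k n := by
  refine ⟨shift_mem_timeIdeal dx 1, fun h => ?_⟩
  rw [← (shiftEquiv dx).symm_apply_apply f]
  exact shift_mem_timeIdeal dx (-1) h

theorem dt_mem_timeIdeal (dX : Derivation ℂ K K) (h : f ∈ timeIdeal K k (n + 1)) :
    dt dX (k + 1) f ∈ timeIdeal K k n := fun e m hm => by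
  rw [coeff_dt, coeff_dtCoeff_succ, h e _ (by simpa using hm), zero_mul]

theorem mem_timeIdeal_succ (dX : Derivation ℂ K K) (h₁ : f ∈ timeIdeal K k 1)
    (h : dt dX (k + 1) f ∈ timeIdeal K k n) : f ∈ timeIdeal K k (n + 1) := fun e m hm => by
  rcases Nat.eq_zero_or_pos (m k) with h0 | h0
  · exact h₁ e m (by omega)
  · have hp : m - Finsupp.single k 1 + Finsupp.single k 1 = m :=
      tsub_add_cancel_of_le (Finsupp.single_le_iff.mpr h0)
    have := h e (m - Finsupp.single k 1) (by simp; omega)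
    rw [coeff_dt, coeff_dtCoeff_succ, hp] at this
    exact mul_natCast_add_one_cancel (this.trans (zero_mul _).symm)

theorem exists_dt_eq (dX : Derivation ℂ K K) (k : ℕ) (f : Ser K) :
    ∃ g ∈ timeIdeal K k 1, dt dX (k + 1) g = f := by
  refine ⟨serMk fun e m => if m k = 0 then 0 else
    ((m k : ℂ))⁻¹ • MvPowerSeries.coeff (m - Finsupp.single k 1) (PowerSeries.coeff e f),
    fun e m hm => ?_, ?_⟩
  · rw [coeff_serMk, if_pos (by omega)]
  · ext e m
    rw [coeff_dt, coeff_dtCoeff_succ, coeff_serMk, if_neg (by simp), add_tsub_cancel_right,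
      smul_mul_assoc, Finsupp.add_apply, Finsupp.single_eq_same, Nat.cast_add_one, inv_smul_mul_natCast_add_one]

/-- Picard iteration for the Cauchy problem in the time `t_{k+1}`. -/
theorem exists_flow {κ : Type*} (dX : Derivation ℂ K K) (k : ℕ) (y₀ : κ → Ser K)
    (P : (κ → Ser K) → κ → Ser K)
    (hP : ∀ n x y, (∀ i, x i - y i ∈ timeIdeal K k n) → ∀ i, P x i - P y i ∈ timeIdeal K k n) :
    ∃ y : κ → Ser K, ∀ i, y i - y₀ i ∈ timeIdeal K k 1 ∧ dt dX (k + 1) (y i) = P y i := by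
  choose J hJ hdJ using exists_dt_eq dX k
  let step : (κ → Ser K) → κ → Ser K := fun y i => y₀ i - J (dt dX (k + 1) (y₀ i)) + J (P y i)
  have hstep : ∀ y i, dt dX (k + 1) (step y i) = P y i := fun y i => by
    simp only [step, map_add, map_sub, hdJ, sub_self, zero_add]
  have hstep₀ : ∀ y i, step y i - y₀ i ∈ timeIdeal K k 1 := fun y i => by
    have := (timeIdeal K k 1).sub_mem (hJ (P y i)) (hJ (dt dX (k + 1) (y₀ i)))
    convert this using 1
    simp only [step]
    ring
  let z : ℕ → κ → Ser K := fun n => step^[n] y₀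
  have hz : ∀ n, z (n + 1) = step (z n) := fun n => Function.iterate_succ_apply' step n y₀
  have hz₁ : ∀ n i, z (n + 1) i - z n i ∈ timeIdeal K k n := fun n => by
    induction n with
    | zero => exact fun i => mem_timeIdeal_zero k _
    | succ n ih =>
      intro i
      refine mem_timeIdeal_succ dX ?_ ?_
      · have := (timeIdeal K k 1).sub_mem (hstep₀ (z (n + 1)) i) (hstep₀ (z n) i)
        rwa [sub_sub_sub_cancel_right, ← hz, ← hz] at this
      · rw [hz, hz n, map_sub, hstep, hstep, ← hz n]
        exact hP n _ _ ih i
  have hz₂ : ∀ n l i, z (n + l) i - z n i ∈ timeIdeal K k n := fun n l i => by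
    induction l with
    | zero => simp
    | succ l ih =>
      have := (timeIdeal K k n).add_mem (timeIdeal_anti k (Nat.le_add_right n l) (hz₁ (n + l) i)) ih
      rwa [sub_add_sub_cancel] at this
  let y : κ → Ser K := fun i => serMk fun e m =>
    MvPowerSeries.coeff m (PowerSeries.coeff e (z (m k + 1) i))
  have hy : ∀ n i, y i - z n i ∈ timeIdeal K k n := fun n i e m hm => by
    obtain ⟨l, rfl⟩ := Nat.exists_eq_add_of_lt hm
    have h := hz₂ (m k + 1) l i e m (Nat.lt_succ_self _)
    rw [map_sub, map_sub, sub_eq_zero] at h ⊢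
    rw [show m k + l + 1 = m k + 1 + l by ring, h, coeff_serMk]
  refine ⟨y, fun i => ⟨?_, ?_⟩⟩
  · have := (timeIdeal K k 1).add_mem (hy 1 i) (hstep₀ (z 0) i)
    rwa [← hz, sub_add_sub_cancel] at this
  · rw [← sub_eq_zero]
    refine eq_zero_of_mem_timeIdeal (k := k) fun n => ?_
    have h₁ := dt_mem_timeIdeal dX (hy (n + 1) i)
    rw [map_sub, hz, hstep] at h₁
    have h₂ := (timeIdeal K k n).sub_mem h₁ (hP n y (z n) (hy n) i)
    rwa [sub_sub_sub_cancel_right] at h₂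

end TimeIdeal

section TodaFlow

variable {K : Type*} [CommRing K] [Algebra ℂ K] {dx dX : Derivation ℂ K K} {v w : Ser K}

theorem shift_sub_mem_timeIdeal {k n : ℕ} (dx : Derivation ℂ K K) (s : ℤ) {f g : Ser K}
    (h : f - g ∈ timeIdeal K k n) : shift dx s f - shift dx s g ∈ timeIdeal K k n := by
  rw [shift_eq_opSeries, shift_eq_opSeries, ← opSeries_sub]
  exact opSeries_mem_timeIdeal _ _ h

/-- The Cauchy problem for a single flow of the Toda lattice hierarchy. -/
theorem exists_todaFlow (dx dX : Derivation ℂ K K) (k : ℕ) (v w : Ser K) :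
    ∃ v' w' : Ser K, v' - v ∈ timeIdeal K k 1 ∧ w' - w ∈ timeIdeal K k 1 ∧
      eps * dt dX (k + 1) v' = shift dx 1 (todaA (shift dx) v' w' (k + 2))
        - todaA (shift dx) v' w' (k + 2) ∧
      eps * dt dX (k + 1) w' = w' * (shift dx 1 (todaC (shift dx) v' w' (k + 2))
        - todaC (shift dx) v' w' (k + 2)) := by
  let δ : Ser K → Ser K := fun f => serDeriv dx (opSeries (mapDeriv dx) expQuot f)
  have hδ : ∀ {n f g}, f - g ∈ timeIdeal K k n → δ f - δ g ∈ timeIdeal K k n := fun h => by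
    simp only [δ]
    rw [← map_sub, ← opSeries_sub]
    exact serDeriv_mem_timeIdeal _ (opSeries_mem_timeIdeal _ _ h)
  obtain ⟨y, hy⟩ := exists_flow dX k ![v, w]
    (fun y => ![δ (todaA (shift dx) (y 0) (y 1) (k + 2)),
      y 1 * δ (todaC (shift dx) (y 0) (y 1) (k + 2))])
    (fun n x y h => by
      obtain ⟨ha, hc⟩ := (isRingRel_ideal (timeIdeal K k n)).todaCoeff
        (fun s _ _ => shift_sub_mem_timeIdeal dx s) (h 0) (h 1) (k + 2)
      exact Fin.forall_fin_two.mpr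
        ⟨hδ ha, (isRingRel_ideal (timeIdeal K k n)).mul (h 1) (hδ hc)⟩)
  refine ⟨y 0, y 1, (hy 0).1, (hy 1).1, ?_, ?_⟩
  · rw [(hy 0).2, shift_sub_self]
    rfl
  · rw [(hy 1).2, shift_sub_self]
    exact mul_left_comm _ _ _

/-- A flow of the Toda lattice hierarchy preserves the first flow. -/
theorem IsDifferenceSolution.of_todaFlow (hcomm : ∀ g, dx (dX g) = dX (dx g)) {k : ℕ}
    (h : IsDifferenceSolution dx dX v w) {v' w' : Ser K}
    (hv : v' - v ∈ timeIdeal K k 1) (hw : w' - w ∈ timeIdeal K k 1)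
    (hv' : eps * dt dX (k + 1) v' = shift dx 1 (todaA (shift dx) v' w' (k + 2))
        - todaA (shift dx) v' w' (k + 2))
    (hw' : eps * dt dX (k + 1) w' = w' * (shift dx 1 (todaC (shift dx) v' w' (k + 2))
        - todaC (shift dx) v' w' (k + 2))) :
    IsDifferenceSolution dx dX v' w' := by
  set Λ := shiftEquiv dx with hΛ
  set a := todaA (shift dx) v' w' (k + 2)
  set c := todaC (shift dx) v' w' (k + 2)
  let D : Derivation ℂ (Ser K) (Ser K) := (eps : Ser K) • dt dX 0
  have hDe : ∀ f, D f = eps * dt dX 0 f := fun f => rfl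
  have hD : ∀ f, D (Λ f) = Λ (D f) := fun f => by
    rw [hDe, hDe, hΛ, shiftEquiv_apply, shiftEquiv_apply, ← shift_dt hcomm, shift_eps_mul]
  have hD' : ∀ f, D (Λ.symm f) = Λ.symm (D f) := fun f => by
    rw [RingEquiv.eq_symm_apply, ← hD, RingEquiv.apply_symm_apply]
  have hDt : ∀ f, eps * dt dX (k + 1) (D f) = D (eps * dt dX (k + 1) f) := fun f => by
    rw [hDe, hDe, dt_eps_mul, dt_eps_mul, dt_comm]
  have hΛt : ∀ f, eps * dt dX (k + 1) (Λ f) = Λ (eps * dt dX (k + 1) f) := fun f => by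
    rw [hΛ, shiftEquiv_apply, shiftEquiv_apply, ← shift_dt hcomm, shift_eps_mul]
  have hΛt' : ∀ f, eps * dt dX (k + 1) (Λ.symm f) = Λ.symm (eps * dt dX (k + 1) f) := fun f => by
    rw [RingEquiv.eq_symm_apply, ← hΛt, RingEquiv.apply_symm_apply]
  have hDI : ∀ {n f g}, f - g ∈ timeIdeal K k n → D f - D g ∈ timeIdeal K k n := fun h => by
    rw [← map_sub]
    exact Ideal.mul_mem_left _ _ (serDeriv_mem_timeIdeal dX h)
  set e₁ := D v' - (Λ w' - w') with he₁
  set e₂ := D w' - w' * (v' - Λ.symm v') with he₂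
  have hv₀ : D v - (Λ w - w) = 0 := sub_eq_zero.mpr h.1.symm
  have hw₀ : D w - w * (v - Λ.symm v) = 0 := sub_eq_zero.mpr h.2.symm
  have hr := isRingRel_ideal (timeIdeal K k 1)
  have h₁ : e₁ ∈ timeIdeal K k 1 := by
    have := hr.sub (hDI hv) (hr.sub (shift_sub_mem_timeIdeal dx 1 hw) hw)
    change e₁ - (D v - (Λ w - w)) ∈ _ at this
    rwa [hv₀, sub_zero] at this
  have h₂ : e₂ ∈ timeIdeal K k 1 := by
    have := hr.sub (hDI hw) (hr.mul hw (hr.sub hv (shift_sub_mem_timeIdeal dx (-1) hv)))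
    change e₂ - (D w - w * (v - Λ.symm v)) ∈ _ at this
    rwa [hw₀, sub_zero] at this
  have hv'' : eps * dt dX (k + 1) v' = Λ a - a := hv'
  have hw'' : eps * dt dX (k + 1) w' = w' * (Λ c - c) := hw'
  have ht₁ : eps * dt dX (k + 1) e₁
      = Λ (D a - w' * (Λ c - c)) - (D a - w' * (Λ c - c)) := by
    rw [he₁, map_sub, map_sub, mul_sub, mul_sub, hDt, hΛt, hv'', hw'']
    simp only [map_sub, map_mul, hD]
    ring
  have ht₂ : eps * dt dX (k + 1) e₂ = e₂ * (Λ c - c)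
      + w' * ((D (Λ c) - (Λ a - a)) - Λ.symm (D (Λ c) - (Λ a - a))) := by
    have hL : eps * dt dX (k + 1) (w' * (v' - Λ.symm v'))
        = w' * (Λ a - a - Λ.symm (Λ a - a)) + (v' - Λ.symm v') * (w' * (Λ c - c)) := by
      rw [Derivation.leibniz, smul_eq_mul, smul_eq_mul, map_sub, mul_add, mul_left_comm,
        mul_sub eps, hΛt', hv'', mul_left_comm eps, hw'']
    have hc : Λ.symm (D (Λ c)) = D c := by rw [hD, RingEquiv.symm_apply_apply]
    rw [he₂, map_sub, mul_sub, hDt, hL, hw'', Derivation.leibniz, smul_eq_mul, smul_eq_mul,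
      map_sub]
    simp only [map_sub, hc]
    ring
  have key : ∀ n, e₁ ∈ timeIdeal K k n ∧ e₂ ∈ timeIdeal K k n := fun n => by
    induction n with
    | zero => exact ⟨mem_timeIdeal_zero k _, mem_timeIdeal_zero k _⟩
    | succ n ih =>
      obtain ⟨hN₁, hN₃⟩ := (isTodaResolvent (sh := shift dx) (v := v') (w := w')
        (Λ := Λ) (shiftEquiv_apply dx) (shiftEquiv_symm_apply dx)).first_flow_mem
        (I := timeIdeal K k n) (mem_timeIdeal_iff_shiftEquiv dx) hD ih.1 ih.2 (k + 2 + 1)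
      rw [coeff_succ_todaAlpha, coeff_succ_todaGamma] at hN₁ hN₃
      refine ⟨mem_timeIdeal_succ dX h₁ (mem_timeIdeal_of_eps_mul ?_),
        mem_timeIdeal_succ dX h₂ (mem_timeIdeal_of_eps_mul ?_)⟩
      · rw [ht₁]
        exact Ideal.sub_mem _ (shift_mem_timeIdeal dx 1 hN₁) hN₁
      · rw [ht₂]
        exact Ideal.add_mem _ (Ideal.mul_mem_right _ _ ih.2) (Ideal.mul_mem_left _ _
          (Ideal.sub_mem _ hN₃ (shift_mem_timeIdeal dx (-1) hN₃)))
  have e₁0 := eq_zero_of_mem_timeIdeal fun n => (key n).1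
  have e₂0 := eq_zero_of_mem_timeIdeal fun n => (key n).2
  exact ⟨(sub_eq_zero.mp e₁0).symm, (sub_eq_zero.mp e₂0).symm⟩

/-- The flow `t_j` of the NLS hierarchy in terms of `V = ε ∂_X q / q` and `W = q r`. -/
def IsJetFlow (dX : Derivation ℂ K K) (j : ℕ) (V W : Ser K) : Prop :=
  dt dX j V = dt dX 0 (jetCoeff (fun f => eps * dt dX 0 f) V W (j + 1)).2.1 ∧
  eps * dt dX j W = W * (jetCoeff (fun f => eps * dt dX 0 f) V W (j + 1)).2.1
    - (jetCoeff (fun f => eps * dt dX 0 f) V W (j + 1)).2.2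

theorem IsNLSSolution.isJetFlow {φ W : Ser K} (h : IsNLSSolution dX φ W) (j : ℕ) :
    IsJetFlow dX j (dt dX 0 φ) W :=
  ⟨by rw [dt_comm, (h.jet j).1], (h.jet j).2⟩

theorem IsJetFlow.sub_mem_timeIdeal {k : ℕ} {V W V' W' : Ser K} (h : IsJetFlow dX (k + 1) V W)
    (h' : IsJetFlow dX (k + 1) V' W') (hV : V' - V ∈ timeIdeal K k 1)
    (hW : W' - W ∈ timeIdeal K k 1) (n : ℕ) :
    V' - V ∈ timeIdeal K k n ∧ W' - W ∈ timeIdeal K k n := by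
  induction n with
  | zero => exact ⟨mem_timeIdeal_zero k _, mem_timeIdeal_zero k _⟩
  | succ n ih =>
    have hr := isRingRel_ideal (timeIdeal K k n)
    have hD : ∀ f g, f - g ∈ timeIdeal K k n → dt dX 0 f - dt dX 0 g ∈ timeIdeal K k n :=
      fun f g h => by
        rw [← map_sub]
        exact serDeriv_mem_timeIdeal dX h
    obtain ⟨-, hg, hh⟩ := hr.jetCoeff (D := fun f => eps * dt dX 0 f)
      (D' := fun f => eps * dt dX 0 f) (fun f g h => by
        rw [← mul_sub]
        exact Ideal.mul_mem_left _ _ (hD f g h)) ih.1 ih.2 (k + 1 + 1)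
    refine ⟨mem_timeIdeal_succ dX hV ?_, mem_timeIdeal_succ dX hW (mem_timeIdeal_of_eps_mul ?_)⟩
    · rw [map_sub, h.1, h'.1]
      exact hD _ _ hg
    · rw [map_sub, mul_sub, h.2, h'.2]
      exact hr.sub (hr.mul ih.2 hg) hh

theorem IsDifferenceSolution.isJetFlow (hcomm : ∀ g, dx (dX g) = dX (dx g)) {j : ℕ}
    (h : IsDifferenceSolution dx dX v w)
    (hv : eps * dt dX j v = shift dx 1 (todaA (shift dx) v w (j + 1))
        - todaA (shift dx) v w (j + 1))
    (hw : eps * dt dX j w = w * (shift dx 1 (todaC (shift dx) v w (j + 1))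
        - todaC (shift dx) v w (j + 1))) : IsJetFlow dX j v w := by
  rw [IsJetFlow, h.jetCoeff_eq hcomm, hw, mul_sub]
  refine ⟨eps_mul_cancel ?_, rfl⟩
  have := ((isTodaResolvent (sh := shift dx) (v := v) (w := w) (Λ := shiftEquiv dx)
    (shiftEquiv_apply dx) (shiftEquiv_symm_apply dx)).first_flow_mem (I := ⊥) (by simp)
    (D := (eps : Ser K) • dt dX 0) (fun f => by
      simp only [Derivation.smul_apply, smul_eq_mul, shiftEquiv_apply]
      rw [← shift_dt hcomm, shift_eps_mul])
    (sub_eq_zero.mpr h.1.symm) (sub_eq_zero.mpr h.2.symm) (j + 1 + 1)).2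
  rw [coeff_succ_todaAlpha, coeff_succ_todaGamma, Ideal.mem_bot, sub_eq_zero] at this
  rw [hv]
  exact this.symm

theorem IsJetFlow.serMap {K' : Type*} [CommRing K'] [Algebra ℂ K'] {dX' : Derivation ℂ K' K'}
    (F : K →+* K') (hF : ∀ g, F (dX g) = dX' (F g)) {j : ℕ} (h : IsJetFlow dX j v w) :
    IsJetFlow dX' j (serMap F v) (serMap F w) := by
  obtain ⟨-, hg, hh⟩ := (isRingRel_hom (TodaNLS.serMap F)).jetCoeff
    (D := fun f => eps * dt dX 0 f) (D' := fun f => eps * dt dX' 0 f) (fun f g h => by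
      rw [map_mul, serMap_eps, serMap_dt F hF, h]) (V := v) (W := w) rfl rfl (j + 1)
  rw [IsJetFlow, ← hg, ← hh, ← serMap_dt F hF, ← serMap_dt F hF, ← serMap_dt F hF, h.1,
    ← serMap_eps F, ← map_mul, h.2, map_sub, map_mul]
  exact ⟨rfl, rfl⟩

end TodaFlow

section InitialValueProblem

variable {F : Type*} [CommRing F] [Algebra ℂ F] {dX : Derivation ℂ F F} {φ W : Ser F}
  {v w : Ser (PowerSeries F)}

theorem dxPS_dXPS_comm (dX : Derivation ℂ F F) (g : PowerSeries F) :
    dxPS F (dXPS dX g) = dXPS dX (dxPS F g) := by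
  ext n
  have h : ∀ (f : PowerSeries F) n, PowerSeries.coeff n (dxPS F f)
      = PowerSeries.coeff (n + 1) f * ((n : F) + 1) := fun f n => PowerSeries.coeff_derivative f n
  rw [dXPS, coeff_mapDeriv, h, h, coeff_mapDeriv, derivation_mul_natCast_add_one]

theorem constantCoeff_dXPS (dX : Derivation ℂ F F) (g : PowerSeries F) :
    PowerSeries.constantCoeff (dXPS dX g) = dX (PowerSeries.constantCoeff g) := by
  simp only [← PowerSeries.coeff_zero_eq_constantCoeff_apply]
  exact coeff_mapDeriv dX g 0

theorem SolvesInitialValueProblem.isTodaSolution (hNLS : IsNLSSolution dX φ W)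
    (hvw : SolvesInitialValueProblem dX φ W v w)
    (huniq : ∀ v' w', SolvesInitialValueProblem dX φ W v' w' → v' = v ∧ w' = w) :
    IsTodaSolution (dxPS F) (dXPS dX) v w := by
  intro j
  match j with
  | 0 =>
    rw [todaA_shift_one, shift_todaC_shift_one, todaC_shift_one]
    exact ⟨hvw.1.1.symm, hvw.1.2.symm⟩
  | k + 1 =>
    have hcomm := dxPS_dXPS_comm dX
    obtain ⟨v', w', hv, hw, hv', hw'⟩ := exists_todaFlow (dxPS F) (dXPS dX) k v w
    have hdiff := hvw.1.of_todaFlow hcomm hv hw hv' hw'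
    have hjet₀ : IsJetFlow (dXPS dX) (k + 1) v' w' := hdiff.isJetFlow hcomm hv' hw'
    have hjet : IsJetFlow dX (k + 1) (serMap PowerSeries.constantCoeff v')
        (serMap PowerSeries.constantCoeff w') :=
      IsJetFlow.serMap (dX' := dX) (PowerSeries.constantCoeff (R := F))
        (fun g => constantCoeff_dXPS dX g) hjet₀
    change IsJetFlow dX (k + 1) (atZero v') (atZero w') at hjet
    have hV : atZero v' - dt dX 0 φ ∈ timeIdeal F k 1 := by
      rw [← hvw.2.1, ← map_sub]
      exact serMap_mem_timeIdeal _ hv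
    have hW : atZero w' - W ∈ timeIdeal F k 1 := by
      rw [← hvw.2.2, ← map_sub]
      exact serMap_mem_timeIdeal _ hw
    have key := (hNLS.isJetFlow (k + 1)).sub_mem_timeIdeal hjet hV hW
    obtain ⟨rfl, rfl⟩ := huniq v' w' ⟨hdiff,
      sub_eq_zero.mp (eq_zero_of_mem_timeIdeal fun n => (key n).1),
      sub_eq_zero.mp (eq_zero_of_mem_timeIdeal fun n => (key n).2)⟩
    exact ⟨hv', hw'⟩

end InitialValueProblem

section Functoriality

variable {K : Type*} [CommRing K] [Algebra ℂ K] {dx dX : Derivation ℂ K K} {v w : Ser K}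
  {K' : Type*} [CommRing K'] [Algebra ℂ K'] {dx' dX' : Derivation ℂ K' K'}

theorem IsTodaSolution.serMap (F : K →ₐ[ℂ] K') (hx : ∀ g, F (dx g) = dx' (F g))
    (hX : ∀ g, F (dX g) = dX' (F g)) (h : IsTodaSolution dx dX v w) :
    IsTodaSolution dx' dX' (serMap (F : K →+* K') v) (serMap (F : K →+* K') w) := by
  intro j
  obtain ⟨ha, hc⟩ := (isRingRel_hom (TodaNLS.serMap (F : K →+* K'))).todaCoeff
    (sh := shift dx) (sh' := shift dx') (fun s f g h => by rw [serMap_shift F hx, h])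
    (v := v) (w := w) rfl rfl (j + 1)
  rw [← ha, ← hc, ← serMap_dt (F : K →+* K') hX, ← serMap_dt (F : K →+* K') hX,
    ← serMap_shift F hx, ← serMap_shift F hx, ← serMap_eps (F : K →+* K'), ← map_mul, ← map_mul,
    (h j).1, (h j).2, map_sub, map_mul, map_sub]
  exact ⟨rfl, rfl⟩

end Functoriality

end TodaNLS

end

theorem theorem3 {F : Type*} [CommRing F] [Algebra ℂ F] (dX : Derivation ℂ F F)
    (φ W : TodaNLS.Ser F) (hNLS : TodaNLS.IsNLSSolution dX φ W)
    (v w : TodaNLS.Ser (PowerSeries F))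
    (hvw : TodaNLS.SolvesInitialValueProblem dX φ W v w)
    (huniq : ∀ v' w' : TodaNLS.Ser (PowerSeries F),
      TodaNLS.SolvesInitialValueProblem dX φ W v' w' → v' = v ∧ w' = w) :
    TodaNLS.IsTodaSolution (TodaNLS.dxPS F) (TodaNLS.dXPS dX) v w ∧
    ∀ (G : Type*) [CommRing G] [Algebra ℂ G] (δx δX : Derivation ℂ G G)
      (ι : PowerSeries F →ₐ[ℂ] G) (vG wG L : TodaNLS.Ser G),
      (∀ g : G, δx (δX g) = δX (δx g)) →
      (∀ a b : G, δX a = δx b → ∃ f : G, δx f = a ∧ δX f = b) →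
      (∀ f : PowerSeries F, ι (TodaNLS.dxPS F f) = δx (ι f)) →
      (∀ f : PowerSeries F, ι (TodaNLS.dXPS dX f) = δX (ι f)) →
      vG = TodaNLS.serMap (ι : PowerSeries F →+* G) v →
      wG = TodaNLS.serMap (ι : PowerSeries F →+* G) w →
      TodaNLS.IsLogOf δx δX L wG →
      (∃ Φ : TodaNLS.Ser G, TodaNLS.IsEpsLogQ δx δX vG wG L Φ) ∧
      (∀ Φ Φ' : TodaNLS.Ser G, TodaNLS.IsEpsLogQ δx δX vG wG L Φ →
        TodaNLS.IsEpsLogQ δx δX vG wG L Φ' →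
        TodaNLS.serDeriv δx (Φ' - Φ) = 0 ∧ ∀ k : ℕ, TodaNLS.dt δX k (Φ' - Φ) = 0) ∧
      ∀ Φ : TodaNLS.Ser G, TodaNLS.IsEpsLogQ δx δX vG wG L Φ →
        (∃ T : TodaNLS.Ser G, TodaNLS.IsNLSTau δx δX vG wG Φ T) ∧
        ∀ T : TodaNLS.Ser G, TodaNLS.IsNLSTau δx δX vG wG Φ T →
          TodaNLS.IsTodaTau δx δX vG wG L T := by
  have h := hvw.isTodaSolution hNLS huniq
  refine ⟨h, fun G _ _ δx δX ι vG wG L hcomm hexact hιx hιX hv hw hL => ?_⟩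
  have hG : TodaNLS.IsTodaSolution δx δX vG wG := by
    rw [hv, hw]
    exact h.serMap ι hιx hιX
  exact ⟨hG.exists_epsLogQ hcomm hexact hL, fun Φ Φ' => TodaNLS.IsEpsLogQ.sub_eq_zero,
    fun Φ hΦ => ⟨hG.exists_nlsTau hcomm hexact hΦ, fun T => hG.isTodaTau hcomm hΦ⟩⟩
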